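/- Formal group laws are one-dimensional and commutative. A strict isomorphism $\gamma\colon F_1\to F_2$ of formal group laws over a commutative ring $A$ is a power series $\gamma(t)\in t+t^2A[[t]]$ with $\gamma(F_2(x,y))=F_1(\gamma(x),\gamma(y))$. Let $\mathbb L$ be the Lazard ring with its universal formal group law $F_{\mathbb L}$, and let $\mathbb LB=\mathbb L[b_1,b_2,\dots]$ and $\gamma(t)=t+\sum_{i\ge1}b_it^{i+1}$. Let $S\colon\mathbb L\to\mathbb LB$ be the ring map that classifies $\gamma(F_{\mathbb L}(\gamma^{-1}(x),\gamma^{-1}(y)))$, let $\varepsilon\colon\mathbb LB\to\mathbb L$ be the $\mathbb L$-algebra map with $b_i\mapsto 0$, and let $\Delta\colon\mathbb LB\to\mathbb LB\otimes_{\mathbb L}\mathbb LB$ (where $\mathbb L$ acts on the left factor through $S$ and on the right factor through the inclusion) be the ring map with $l\mapsto l\otimes 1$ for $l\in\mathbb L$ that sends the coefficients of $\gamma$ to those of $\gamma_2(\gamma_1(t))$, where $\gamma_1,\gamma_2$ are the images of $\gamma$ under $x\mapsto x\otimes1$ and $x\mapsto1\otimes x$. An $(\mathbb L,\mathbb LB)$-comodule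 is an $\mathbb L$-module $M$ with an additive map $\psi\colon M\to M\otimes_{\mathbb L}\mathbb LB$ such that $\psi(lm)=\psi(m)S(l)$, $(\mathrm{id}\otimes\varepsilon)\psi=\mathrm{id}$ and $(\mathrm{id}\otimes\Delta)\psi=(\psi\otimes\mathrm{id})\psi$. Let $p$ be a prime. A formal group law $F$ over a $\mathbb Z_{(p)}$-algebra $A$ is $p$-typical if for every prime $q\ne p$ the formal sum $\sum^F_{0\le i<q}\zeta^i t$ vanishes in $A[\zeta][[t]]$, where $A[\zeta]=A[z]/(\Phi_q(z))$, $\Phi_q$ is the $q$-th cyclotomic polynomial and $\zeta$ is the class of $z$. Let $\mathbb L\to BP$ be the map that classifies the universal $p$-typical formal group law $F_{BP}$ over $BP$, and let $\mathbb L_{(p)}$ be the localization of $\mathbb L$ at $p$. Let $M$ be an $(\mathbb L,\mathbb LB)$-comodule. Then: 1. There is a ring map $g\colon BP\to\mathbb L_{(p)}$ such that the $p$-typical formal group law $g_*F_{BP}$ is strictly isomorphic to the formal group law that $F_{\mathbb L}$ induces over $\mathbb L_{(p)}$. 2. For every such $g$, the modules $M\otimes_{\mathbb L}\mathbb L_{(p)}$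 and $(M\otimes_{\mathbb L}BP)\otimes_{BP,g}\mathbb L_{(p)}$ are isomorphic as $\mathbb L_{(p)}$-modules, hence as $\mathbb L$-modules. 3. More generally, let $f_1,f_2\colon\mathbb L\to A$ be ring maps to a commutative ring $A$ and let $\gamma_A$ be a strict isomorphism from $(f_1)_*F_{\mathbb L}$ to $(f_2)_*F_{\mathbb L}$. Let $\varphi\colon\mathbb LB\to A$ be the ring map that restricts to $f_2$ on $\mathbb L$ and sends $b_i$ to the coefficient of $t^{i+1}$ in $\gamma_A(t)$. Then there is a unique isomorphism of $A$-modules $h\colon M\otimes_{\mathbb L,f_1}A\to M\otimes_{\mathbb L,f_2}A$ with $h(m\otimes1)=(\mathrm{id}\otimes\varphi)(\psi(m))$ for all $m\in M$. -/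

import Mathlib

open scoped TensorProduct

noncomputable section

namespace LazardBP

/-! ### Strict isomorphisms of formal group laws

`FormalGroup R` is Mathlib's type of one-dimensional formal group laws `F(X, Y)` over `R`,
`F.IsComm` says that `F` is commutative, and `F.map f` is the push-forward along `f`. -/

section FormalGroupLaws

variable {R S : Type*} [CommRing R] [CommRing S]

theorem hasSubst_pair {σ : Type*} {a b : MvPowerSeries σ R}
    (ha : PowerSeries.HasSubst a) (hb : PowerSeries.HasSubst b) :
    MvPowerSeries.HasSubst ![a, b] :=
  MvPowerSeries.hasSubst_of_constantCoeff_nilpotent fun s => by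
    fin_cases s <;> simpa

theorem map_pair {σ : Type*} (f : R →+* S) (a b : MvPowerSeries σ R) :
    (fun i => MvPowerSeries.map f (![a, b] i)) =
      ![MvPowerSeries.map f a, MvPowerSeries.map f b] := by
  ext1 i; fin_cases i <;> simp

theorem subst_pair_subst {σ τ : Type*} (G : MvPowerSeries (Fin 2) R)
    {a b : MvPowerSeries σ R} (ha : PowerSeries.HasSubst a) (hb : PowerSeries.HasSubst b)
    {c : σ → MvPowerSeries τ R} (hc : MvPowerSeries.HasSubst c) :
    MvPowerSeries.subst c (MvPowerSeries.subst ![a, b] G) =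
      MvPowerSeries.subst ![MvPowerSeries.subst c a, MvPowerSeries.subst c b] G := by
  rw [MvPowerSeries.subst_comp_subst_apply (hasSubst_pair ha hb) hc]
  congr! 2 with s
  fin_cases s <;> simp

theorem hasSubst_formalAdd (F : FormalGroup R) {σ : Type*} {a b : MvPowerSeries σ R}
    (ha : PowerSeries.HasSubst a) (hb : PowerSeries.HasSubst b) :
    PowerSeries.HasSubst (F.toPowerSeries.subst ![a, b]) :=
  MvPowerSeries.IsNilpotent_subst (hasSubst_pair ha hb)
    (F.zero_constantCoeff ▸ IsNilpotent.zero)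

theorem isComm_map (F : FormalGroup R) [hF : F.IsComm] (f : R →+* S) : (F.map f).IsComm where
  comm := by
    have h := congrArg (MvPowerSeries.map f) hF.comm
    rw [MvPowerSeries.map_subst MvPowerSeries.HasSubst.X_X, map_pair] at h
    simpa using h

/-- A strict isomorphism `γ : F₁ → F₂` of formal group laws over `R`: a series
`γ(t) = t + (terms of degree ≥ 2)` with `γ(F₂(x, y)) = F₁(γ(x), γ(y))`. -/
structure IsStrictIso (γ : PowerSeries R) (F₁ F₂ : FormalGroup R) : Prop where
  constantCoeff_eq : PowerSeries.constantCoeff γ = 0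
  coeff_one_eq : PowerSeries.coeff 1 γ = 1
  hom : γ.subst F₂.toPowerSeries =
    F₁.toPowerSeries.subst
      ![γ.subst (MvPowerSeries.X 0 : MvPowerSeries (Fin 2) R),
        γ.subst (MvPowerSeries.X 1 : MvPowerSeries (Fin 2) R)]

/-- Two formal group laws over `R` are strictly isomorphic. -/
def StrictlyIsomorphic (F₁ F₂ : FormalGroup R) : Prop :=
  ∃ γ : PowerSeries R, IsStrictIso γ F₁ F₂

theorem hasSubst_subst {σ : Type*} {γ : PowerSeries R} (h0 : PowerSeries.constantCoeff γ = 0)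
    {a : MvPowerSeries σ R} (ha : PowerSeries.HasSubst a) :
    PowerSeries.HasSubst (γ.subst a) := by
  refine MvPowerSeries.IsNilpotent_subst ha.const ?_
  have : MvPowerSeries.constantCoeff γ = 0 := h0
  rw [this]; exact IsNilpotent.zero

/-- The series `γ(F(γ⁻¹(x), γ⁻¹(y)))`. -/
def twistSeries (F : FormalGroup R) (γ : PowerSeries R) (h1 : PowerSeries.coeff 1 γ = 1) :
    MvPowerSeries (Fin 2) R :=
  γ.subst (F.toPowerSeries.subst
    ![(γ.substInvOfIsUnit (h1 ▸ isUnit_one)).subst (MvPowerSeries.X 0 : MvPowerSeries (Fin 2) R),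
      (γ.substInvOfIsUnit (h1 ▸ isUnit_one)).subst (MvPowerSeries.X 1 : MvPowerSeries (Fin 2) R)])

theorem twistSeries_subst (F : FormalGroup R) (γ : PowerSeries R)
    (h1 : PowerSeries.coeff 1 γ = 1) {σ : Type*} {a b : MvPowerSeries σ R}
    (ha : PowerSeries.HasSubst a) (hb : PowerSeries.HasSubst b) :
    (twistSeries F γ h1).subst ![a, b] =
      γ.subst (F.toPowerSeries.subst
        ![(γ.substInvOfIsUnit (h1 ▸ isUnit_one)).subst a,
          (γ.substInvOfIsUnit (h1 ▸ isUnit_one)).subst b]) := by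
  set δ := γ.substInvOfIsUnit (h1 ▸ isUnit_one) with hδ
  have hδ0 : PowerSeries.constantCoeff δ = 0 := γ.constantCoeff_substInvOfIsUnit _
  have hx (i : Fin 2) : PowerSeries.HasSubst
      (δ.subst (MvPowerSeries.X i : MvPowerSeries (Fin 2) R)) :=
    hasSubst_subst hδ0 (PowerSeries.HasSubst.X i)
  have hc := hasSubst_pair ha hb
  have key (i : Fin 2) : MvPowerSeries.subst ![a, b]
      (δ.subst (MvPowerSeries.X i : MvPowerSeries (Fin 2) R)) = δ.subst (![a, b] i) := by
    rw [PowerSeries.subst, MvPowerSeries.subst_comp_subst_apply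
      (PowerSeries.HasSubst.X i).const hc, MvPowerSeries.subst_X hc]
    rfl
  rw [twistSeries, PowerSeries.subst, MvPowerSeries.subst_comp_subst_apply
    (hasSubst_formalAdd F (hx 0) (hx 1)).const hc, subst_pair_subst _ (hx 0) (hx 1) hc,
    key, key]
  rfl

theorem substInv_subst_subst {γ : PowerSeries R} (h0 : PowerSeries.constantCoeff γ = 0)
    (h1 : IsUnit (PowerSeries.coeff 1 γ)) {σ : Type*} {a : MvPowerSeries σ R}
    (ha : PowerSeries.HasSubst a) :
    (γ.substInvOfIsUnit h1).subst (γ.subst a) = a := by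
  have hγ : PowerSeries.HasSubst γ := PowerSeries.HasSubst.of_constantCoeff_zero' h0
  rw [← PowerSeries.subst_comp_subst_apply hγ ha, γ.subst_substInvOfIsUnit_left h0,
    PowerSeries.subst_X ha]

theorem subst_substInv_subst {γ : PowerSeries R} (h0 : PowerSeries.constantCoeff γ = 0)
    (h1 : IsUnit (PowerSeries.coeff 1 γ)) {σ : Type*} {a : MvPowerSeries σ R}
    (ha : PowerSeries.HasSubst a) :
    γ.subst ((γ.substInvOfIsUnit h1).subst a) = a := by
  have hγ : PowerSeries.HasSubst (γ.substInvOfIsUnit h1) :=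
    PowerSeries.HasSubst.substInvOfIsUnit _ _
  rw [← PowerSeries.subst_comp_subst_apply hγ ha, γ.subst_substInvOfIsUnit_right h0,
    PowerSeries.subst_X ha]

theorem subst_zero_eq {σ : Type*} {δ : PowerSeries R} (h0 : PowerSeries.constantCoeff δ = 0) :
    δ.subst (0 : MvPowerSeries σ R) = 0 :=
  PowerSeries.subst_zero_of_constantCoeff_zero h0

theorem coeff_subst_X_zero (G : MvPowerSeries (Fin 2) R) :
    PowerSeries.coeff 1 (MvPowerSeries.subst ![(PowerSeries.X : PowerSeries R), 0] G) =
      MvPowerSeries.coeff (Finsupp.single 0 1) G := by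
  rw [PowerSeries.coeff, MvPowerSeries.coeff_subst
    (hasSubst_pair PowerSeries.HasSubst.X' PowerSeries.HasSubst.zero'),
    finsum_eq_single _ (Finsupp.single 0 1)]
  · simp
  · intro d hd
    by_cases hd₁ : d 1 = 0
    · have : d 0 ≠ 1 := fun h => hd (by ext i; fin_cases i <;> simp [h, hd₁])
      simp [hd₁, PowerSeries.coeff_X_pow]
      grind
    simp [hd₁]

theorem coeff_subst_zero_X (G : MvPowerSeries (Fin 2) R) :
    PowerSeries.coeff 1 (MvPowerSeries.subst ![0, (PowerSeries.X : PowerSeries R)] G) =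
      MvPowerSeries.coeff (Finsupp.single 1 1) G := by
  rw [PowerSeries.coeff, MvPowerSeries.coeff_subst
    (hasSubst_pair PowerSeries.HasSubst.zero' PowerSeries.HasSubst.X'),
    finsum_eq_single _ (Finsupp.single 1 1)]
  · simp
  · intro d hd
    by_cases hd₁ : d 0 = 0
    · have : d 1 ≠ 1 := fun h => hd (by ext i; fin_cases i <;> simp [h, hd₁])
      simp [hd₁, PowerSeries.coeff_X_pow]
      grind
    simp [hd₁]

/-- The formal group law `F` twisted by `γ(t) = t + ⋯`, that is `γ(F(γ⁻¹(x), γ⁻¹(y)))`. -/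
def twist (F : FormalGroup R) (γ : PowerSeries R) (h0 : PowerSeries.constantCoeff γ = 0)
    (h1 : PowerSeries.coeff 1 γ = 1) : FormalGroup R where
  toPowerSeries := twistSeries F γ h1
  zero_constantCoeff := by
    have hδ0 : PowerSeries.constantCoeff (γ.substInvOfIsUnit (h1 ▸ isUnit_one)) = 0 :=
      γ.constantCoeff_substInvOfIsUnit _
    refine PowerSeries.constantCoeff_subst_eq_zero ?_ _ h0
    refine MvPowerSeries.constantCoeff_subst_eq_zero
      (hasSubst_pair (hasSubst_subst hδ0 (PowerSeries.HasSubst.X 0))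
        (hasSubst_subst hδ0 (PowerSeries.HasSubst.X 1))) (fun i => ?_) F.zero_constantCoeff
    fin_cases i <;>
      exact PowerSeries.constantCoeff_subst_eq_zero (by simp) _ hδ0
  lin_coeff_X := by
    have hδ0 : PowerSeries.constantCoeff (γ.substInvOfIsUnit (h1 ▸ isUnit_one)) = 0 :=
      γ.constantCoeff_substInvOfIsUnit _
    have hX : PowerSeries.HasSubst (PowerSeries.X : PowerSeries R) := PowerSeries.HasSubst.X'
    rw [← coeff_subst_X_zero, twistSeries_subst F γ h1 hX PowerSeries.HasSubst.zero',
      subst_zero_eq hδ0, F.add_zero (hasSubst_subst hδ0 hX), subst_substInv_subst h0 _ hX]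
    simp
  lin_coeff_Y := by
    have hδ0 : PowerSeries.constantCoeff (γ.substInvOfIsUnit (h1 ▸ isUnit_one)) = 0 :=
      γ.constantCoeff_substInvOfIsUnit _
    have hX : PowerSeries.HasSubst (PowerSeries.X : PowerSeries R) := PowerSeries.HasSubst.X'
    rw [← coeff_subst_zero_X, twistSeries_subst F γ h1 PowerSeries.HasSubst.zero' hX,
      subst_zero_eq hδ0, F.zero_add (hasSubst_subst hδ0 hX), subst_substInv_subst h0 _ hX]
    simp
  assoc := by
    have hδ0 : PowerSeries.constantCoeff (γ.substInvOfIsUnit (h1 ▸ isUnit_one)) = 0 :=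
      γ.constantCoeff_substInvOfIsUnit _
    have hX (i : Fin 3) : PowerSeries.HasSubst (MvPowerSeries.X i : MvPowerSeries (Fin 3) R) :=
      PowerSeries.HasSubst.X i
    have hY (i : Fin 3) := hasSubst_subst hδ0 (hX i)
    have hF (i j : Fin 3) := hasSubst_formalAdd F (hY i) (hY j)
    rw [twistSeries_subst F γ h1 (hX 0) (hX 1), twistSeries_subst F γ h1 (hX 1) (hX 2),
      twistSeries_subst F γ h1 (hasSubst_subst h0 (hF 0 1)) (hX 2),
      twistSeries_subst F γ h1 (hX 0) (hasSubst_subst h0 (hF 1 2)),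
      substInv_subst_subst h0 _ (hF 0 1), substInv_subst_subst h0 _ (hF 1 2),
      F.assoc' (hY 0) (hY 1) (hY 2)]

theorem isComm_twist (F : FormalGroup R) [F.IsComm] (γ : PowerSeries R)
    (h0 : PowerSeries.constantCoeff γ = 0) (h1 : PowerSeries.coeff 1 γ = 1) :
    (twist F γ h0 h1).IsComm where
  comm := by
    have hδ0 : PowerSeries.constantCoeff (γ.substInvOfIsUnit (h1 ▸ isUnit_one)) = 0 :=
      γ.constantCoeff_substInvOfIsUnit _
    have hX (i : Fin 2) : PowerSeries.HasSubst (MvPowerSeries.X i : MvPowerSeries (Fin 2) R) :=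
      PowerSeries.HasSubst.X i
    have hY (i : Fin 2) := hasSubst_subst hδ0 (hX i)
    change twistSeries F γ h1 = (twistSeries F γ h1).subst _
    rw [twistSeries_subst F γ h1 (hX 1) (hX 0), F.comm' (hY 1) (hY 0)]
    rfl

/-- `γ` is a strict isomorphism from the twisted formal group law to the original one. -/
theorem isStrictIso_twist (F : FormalGroup R) (γ : PowerSeries R)
    (h0 : PowerSeries.constantCoeff γ = 0) (h1 : PowerSeries.coeff 1 γ = 1) :
    IsStrictIso γ (twist F γ h0 h1) F where
  constantCoeff_eq := h0
  coeff_one_eq := h1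
  hom := by
    have hX (i : Fin 2) : PowerSeries.HasSubst (MvPowerSeries.X i : MvPowerSeries (Fin 2) R) :=
      PowerSeries.HasSubst.X i
    change _ = (twistSeries F γ h1).subst _
    rw [twistSeries_subst F γ h1 (hasSubst_subst h0 (hX 0)) (hasSubst_subst h0 (hX 1)),
      substInv_subst_subst h0 _ (hX 0), substInv_subst_subst h0 _ (hX 1)]
    congr 1
    have : (![MvPowerSeries.X 0, MvPowerSeries.X 1] : Fin 2 → MvPowerSeries (Fin 2) R) =
        MvPowerSeries.X := by
      ext1 i; fin_cases i <;> rfl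
    rw [this, MvPowerSeries.subst_self]; rfl

end FormalGroupLaws

/-! ### The Lazard ring -/

section Lazard

/-- The exponents `(i, j)` with `i + j ≥ 2`. -/
abbrev HigherExponent : Type := {d : Fin 2 →₀ ℕ // 2 ≤ d.degree}

/-- The generic series `X + Y + ∑_{i + j ≥ 2} a_{ij} X^i Y^j`, whose coefficients `a_{ij}` are
indeterminates. -/
def genericSeries : MvPowerSeries (Fin 2) (MvPolynomial HigherExponent ℤ) := fun d =>
  if h : 2 ≤ d.degree then MvPolynomial.X ⟨d, h⟩ else if d = 0 then 0 else 1

/-- For a series `F` in two variables, the difference `F(F(x, y), z) - F(x, F(y, z))`. -/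
def associator {R : Type*} [CommRing R] (F : MvPowerSeries (Fin 2) R) :
    MvPowerSeries (Fin 3) R :=
  F.subst ![F.subst ![MvPowerSeries.X 0, MvPowerSeries.X 1], MvPowerSeries.X 2] -
    F.subst ![MvPowerSeries.X 0, F.subst ![MvPowerSeries.X 1, MvPowerSeries.X 2]]

/-- For a series `F` in two variables, the difference `F(x, y) - F(y, x)`. -/
def commutator {R : Type*} [CommRing R] (F : MvPowerSeries (Fin 2) R) :
    MvPowerSeries (Fin 2) R :=
  F - F.subst ![MvPowerSeries.X 1, MvPowerSeries.X 0]

/-- The ideal of relations between the `a_{ij}` that express associativity and commutativity. -/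
def lazardIdeal : Ideal (MvPolynomial HigherExponent ℤ) :=
  Ideal.span (Set.range (fun d => MvPowerSeries.coeff d (associator genericSeries)) ∪
    Set.range (fun d => MvPowerSeries.coeff d (commutator genericSeries)))

/-- The Lazard ring `𝕃`. -/
def Lazard : Type := MvPolynomial HigherExponent ℤ ⧸ lazardIdeal

instance : CommRing Lazard :=
  inferInstanceAs (CommRing (MvPolynomial HigherExponent ℤ ⧸ lazardIdeal))

/-- The projection from the polynomial ring in the `a_{ij}` to the Lazard ring. -/
def lazardMk : MvPolynomial HigherExponent ℤ →+* Lazard := Ideal.Quotient.mk lazardIdeal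

theorem constantCoeff_genericSeries : MvPowerSeries.constantCoeff genericSeries = 0 := by
  change genericSeries 0 = 0
  simp [genericSeries]

theorem map_associator {R S : Type*} [CommRing R] [CommRing S] (f : R →+* S)
    {F : MvPowerSeries (Fin 2) R} (hF : MvPowerSeries.constantCoeff F = 0) :
    MvPowerSeries.map f (associator F) = associator (MvPowerSeries.map f F) := by
  simp only [associator, map_sub]
  rw [MvPowerSeries.map_subst (MvPowerSeries.HasSubst.cons_subst_zero_left (0 : Fin 3) 1 2 hF),
    MvPowerSeries.map_subst (MvPowerSeries.HasSubst.cons_subst_zero_right (0 : Fin 3) 1 2 hF),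
    map_pair, map_pair, MvPowerSeries.map_subst MvPowerSeries.HasSubst.X_X,
    MvPowerSeries.map_subst MvPowerSeries.HasSubst.X_X, map_pair, map_pair]
  simp only [MvPowerSeries.map_X]

theorem map_commutator {R S : Type*} [CommRing R] [CommRing S] (f : R →+* S)
    (F : MvPowerSeries (Fin 2) R) :
    MvPowerSeries.map f (commutator F) = commutator (MvPowerSeries.map f F) := by
  simp only [commutator, map_sub]
  rw [MvPowerSeries.map_subst MvPowerSeries.HasSubst.X_X, map_pair]
  simp only [MvPowerSeries.map_X]

/-- The universal formal group law over the Lazard ring. -/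
def universalFGL : FormalGroup Lazard where
  toPowerSeries := MvPowerSeries.map lazardMk genericSeries
  zero_constantCoeff := by
    rw [MvPowerSeries.constantCoeff_map, constantCoeff_genericSeries, map_zero]
  lin_coeff_X := by
    rw [MvPowerSeries.coeff_map]
    change lazardMk (genericSeries _) = 1
    simp [genericSeries]
  lin_coeff_Y := by
    rw [MvPowerSeries.coeff_map]
    change lazardMk (genericSeries _) = 1
    simp [genericSeries]
  assoc := by
    rw [← sub_eq_zero]
    change associator _ = 0
    rw [← map_associator _ constantCoeff_genericSeries]
    ext d
    rw [MvPowerSeries.coeff_map, map_zero]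
    exact Ideal.Quotient.eq_zero_iff_mem.mpr (Ideal.subset_span (Or.inl ⟨d, rfl⟩))

instance : universalFGL.IsComm where
  comm := by
    rw [← sub_eq_zero]
    change commutator (MvPowerSeries.map lazardMk genericSeries) = 0
    rw [← map_commutator]
    ext d
    rw [MvPowerSeries.coeff_map, map_zero]
    exact Ideal.Quotient.eq_zero_iff_mem.mpr (Ideal.subset_span (Or.inr ⟨d, rfl⟩))

variable {A : Type*} [CommRing A]

/-- Specialization of the indeterminates `a_{ij}` to the coefficients of a formal group law. -/
def specialize (F : FormalGroup A) : MvPolynomial HigherExponent ℤ →+* A :=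
  MvPolynomial.eval₂Hom (Int.castRingHom A) fun d => MvPowerSeries.coeff d.1 F.toPowerSeries

theorem map_specialize (F : FormalGroup A) :
    MvPowerSeries.map (specialize F) genericSeries = F.toPowerSeries := by
  ext d
  rw [MvPowerSeries.coeff_map]
  change specialize F (genericSeries d) = _
  by_cases h2 : 2 ≤ d.degree
  · simp [genericSeries, h2, specialize]
  by_cases h0 : d = 0
  · subst h0
    simpa [genericSeries] using F.zero_constantCoeff.symm
  have h1 : d.degree = 1 := by
    have := mt (Finsupp.degree_eq_zero_iff d).mp h0
    omega
  have hs : d 0 + d 1 = 1 := by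
    have := Finsupp.degree_eq_sum d
    rw [Fin.sum_univ_two] at this
    omega
  rcases Nat.eq_zero_or_pos (d 0) with hd | hd
  · obtain rfl : d = Finsupp.single 1 1 := by
      ext i; fin_cases i <;> simp <;> omega
    simp [genericSeries, F.lin_coeff_Y]
  · obtain rfl : d = Finsupp.single 0 1 := by
      ext i; fin_cases i <;> simp <;> omega
    simp [genericSeries, F.lin_coeff_X]

/-- The ring homomorphism `𝕃 → A` that classifies a commutative formal group law over `A`. -/
def classify (F : FormalGroup A) [hF : F.IsComm] : Lazard →+* A :=
  Ideal.Quotient.lift lazardIdeal (specialize F) fun a ha => by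
    have hle : lazardIdeal ≤ RingHom.ker (specialize F) := by
      refine Ideal.span_le.mpr ?_
      rintro _ (⟨d, rfl⟩ | ⟨d, rfl⟩)
      · change specialize F _ = 0
        rw [← MvPowerSeries.coeff_map, map_associator _ constantCoeff_genericSeries,
          map_specialize, associator, sub_eq_zero.mpr F.assoc, map_zero]
      · change specialize F _ = 0
        rw [← MvPowerSeries.coeff_map, map_commutator, map_specialize, commutator,
          sub_eq_zero.mpr hF.comm, map_zero]
    exact hle ha

theorem map_classify (F : FormalGroup A) [F.IsComm] : universalFGL.map (classify F) = F := by
  ext1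
  have h : (classify F).comp lazardMk = specialize F := Ideal.Quotient.lift_comp_mk _ _ _
  change MvPowerSeries.map (classify F) (MvPowerSeries.map lazardMk genericSeries) = _
  rw [← map_specialize F, ← h, MvPowerSeries.map_comp]
  rfl

theorem lazard_hom_ext {f g : Lazard →+* A} (h : universalFGL.map f = universalFGL.map g) :
    f = g := by
  refine Ideal.Quotient.ringHom_ext (MvPolynomial.ringHom_ext (fun n => by simp) fun d => ?_)
  have h' := congrArg (fun F : FormalGroup A => MvPowerSeries.coeff d.1 F.toPowerSeries) h
  have hd : MvPowerSeries.coeff d.1 genericSeries = MvPolynomial.X d := by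
    change genericSeries d.1 = _
    simp [genericSeries, d.2]
  simp only [FormalGroup.map_toPowerSeries, universalFGL, MvPowerSeries.coeff_map, hd] at h'
  exact h'

end Lazard

/-! ### Restriction of scalars along a ring homomorphism -/

section Via

variable {R A : Type*} [CommRing R] [CommRing A]

/-- The ring `A` regarded as an `R`-algebra through `f : R →+* A`. For an `R`-module `M`,
`Via f ⊗[R] M` is the `A`-module `M ⊗_{R, f} A`. -/
def Via (_f : R →+* A) : Type _ := A

variable (f : R →+* A)

instance : CommRing (Via f) := inferInstanceAs (CommRing A)

instance : Algebra R (Via f) := f.toAlgebra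

instance : Algebra A (Via f) := Algebra.id A

instance : SMulCommClass R A (Via f) where
  smul_comm r a x := mul_left_comm (f r : A) a (x : A)

/-- The identity map from `A` to `A` regarded as an `R`-algebra through `f`. -/
def Via.of : A →+* Via f := RingHom.id A

end Via

/-! ### The Hopf algebroid `(𝕃, 𝕃B)` and its comodules -/

section HopfAlgebroid

/-- The ring `𝕃B = 𝕃[b₁, b₂, …]`; the variable `MvPolynomial.X n` is `b_{n+1}`. Its structure of
an `𝕃`-algebra is the left unit. -/
abbrev LB : Type := MvPolynomial ℕ Lazard

/-- The series `γ(t) = t + ∑_{i ≥ 1} b_i t^{i+1}` over `𝕃B`. -/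
def gammaLN : PowerSeries LB :=
  PowerSeries.mk fun
    | 0 => 0
    | 1 => 1
    | n + 2 => MvPolynomial.X n

theorem constantCoeff_gammaLN : PowerSeries.constantCoeff gammaLN = 0 := by
  rw [← PowerSeries.coeff_zero_eq_constantCoeff_apply, gammaLN, PowerSeries.coeff_mk]

theorem coeff_one_gammaLN : PowerSeries.coeff 1 gammaLN = 1 := by
  rw [gammaLN, PowerSeries.coeff_mk]

/-- The universal formal group law, extended to `𝕃B` and twisted by `γ`. -/
def twistedFGL : FormalGroup LB :=
  twist (universalFGL.map (algebraMap Lazard LB)) gammaLN constantCoeff_gammaLN coeff_one_gammaLN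

instance : twistedFGL.IsComm :=
  haveI := isComm_map universalFGL (algebraMap Lazard LB)
  isComm_twist _ _ _ _

/-- The right unit `S : 𝕃 → 𝕃B`, which classifies the twisted universal formal group law. -/
def rightUnit : Lazard →+* LB := classify twistedFGL

/-- The counit `ε : 𝕃B → 𝕃`, `b_i ↦ 0`. -/
def counit : LB →ₐ[Lazard] Lazard := MvPolynomial.aeval fun _ => 0

/-- The ring `𝕃B ⊗_𝕃 𝕃B`, where `𝕃` acts on the first factor through the right unit and on the
second factor through the left unit. -/
def LB2 : Type := Via rightUnit ⊗[Lazard] LB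

instance : CommRing LB2 := inferInstanceAs (CommRing (Via rightUnit ⊗[Lazard] LB))

/-- `x ↦ x ⊗ 1`. -/
def inl : LB →+* LB2 :=
  (Algebra.TensorProduct.includeLeftRingHom : Via rightUnit →+* Via rightUnit ⊗[Lazard] LB).comp
    (Via.of rightUnit)

/-- `x ↦ 1 ⊗ x`. -/
def inr : LB →+* LB2 :=
  (Algebra.TensorProduct.includeRight : LB →ₐ[Lazard] Via rightUnit ⊗[Lazard] LB).toRingHom

/-- The map `𝕃 → 𝕃B ⊗_𝕃 𝕃B`, `l ↦ l ⊗ 1`, given by the left unit of the first factor. -/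
def leftUnit2 : Lazard →+* LB2 := inl.comp (algebraMap Lazard LB)

/-- The map `x ↦ x ⊗ 1` as a homomorphism of algebras over `𝕃`, with respect to the left units. -/
def inlAlgHom : LB →ₐ[Lazard] Via leftUnit2 where
  __ := (Via.of leftUnit2).comp inl
  commutes' _ := rfl

/-- The comultiplication `Δ : 𝕃B → 𝕃B ⊗_𝕃 𝕃B`, which is `l ↦ l ⊗ 1` on `𝕃` and maps `γ` to
`γ₂(γ₁(t))`, where `γ₁` and `γ₂` are the images of `γ` under `x ↦ x ⊗ 1` and `x ↦ 1 ⊗ x`. -/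
def comul : LB →ₐ[Lazard] Via leftUnit2 :=
  MvPolynomial.aeval fun n => Via.of leftUnit2 <|
    PowerSeries.coeff (n + 2)
      ((PowerSeries.map inr gammaLN).subst (PowerSeries.map inl gammaLN) : PowerSeries LB2)

theorem inl_rightUnit (l : Lazard) : inl (rightUnit l) = inr (algebraMap Lazard LB l) := by
  exact ((Algebra.TensorProduct.includeRight :
    LB →ₐ[Lazard] Via rightUnit ⊗[Lazard] LB).commutes l).symm

variable {M : Type*} [AddCommGroup M] [Module Lazard M]

theorem inlAlgHom_rTensor_smul (x : LB) (y : LB ⊗[Lazard] M) :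
    inlAlgHom.toLinearMap.rTensor M (x • y) = inl x • inlAlgHom.toLinearMap.rTensor M y := by
  induction y with
  | zero => simp
  | add y z hy hz => rw [smul_add, map_add, hy, hz, map_add, smul_add]
  | tmul a m =>
    rw [TensorProduct.smul_tmul', LinearMap.rTensor_tmul, LinearMap.rTensor_tmul,
      TensorProduct.smul_tmul', smul_eq_mul]
    congr 1
    exact map_mul inlAlgHom x a

/-- For `ψ : M → M ⊗_𝕃 𝕃B`, the map `ψ ⊗ id : M ⊗_𝕃 𝕃B → M ⊗_𝕃 𝕃B ⊗_𝕃 𝕃B`, which sends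
`m ⊗ x` to `ψ(m) ⊗ x`. As everywhere, the ring is written as the left factor of a tensor
product of a ring with `M`. -/
def coactionTensorId (ψ : M →ₛₗ[rightUnit] LB ⊗[Lazard] M) :
    LB ⊗[Lazard] M →+ Via leftUnit2 ⊗[Lazard] M :=
  TensorProduct.liftAddHom
    { toFun := fun x =>
        { toFun := fun m => inr x • inlAlgHom.toLinearMap.rTensor M (ψ m)
          map_zero' := by simp
          map_add' := fun m n => by simp }
      map_zero' := by ext; simp
      map_add' := fun x y => by ext; simp [add_smul] }
    fun l x m => by
      change inr (l • x) • inlAlgHom.toLinearMap.rTensor M (ψ m) =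
        inr x • inlAlgHom.toLinearMap.rTensor M (ψ (l • m))
      rw [map_smulₛₗ ψ, inlAlgHom_rTensor_smul, inl_rightUnit, smul_smul, ← map_mul,
        Algebra.smul_def, mul_comm]

variable (M) in
/-- The structure of a right comodule over the Hopf algebroid `(𝕃, 𝕃B)` on an `𝕃`-module `M`: a
map `ψ : M → M ⊗_𝕃 𝕃B` with `ψ(l m) = ψ(m) S(l)`, where `S` is the right unit and the tensor
product is formed with the left unit, that is counital and coassociative. The tensor product
`M ⊗_𝕃 𝕃B` is written as `LB ⊗[Lazard] M`, which is a module over `LB`. -/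
structure Comodule where
  /-- The coaction `ψ`. -/
  coaction : M →ₛₗ[rightUnit] LB ⊗[Lazard] M
  /-- `(id ⊗ ε) ∘ ψ = id`. -/
  counital : ∀ m, TensorProduct.lid Lazard M (counit.toLinearMap.rTensor M (coaction m)) = m
  /-- `(id ⊗ Δ) ∘ ψ = (ψ ⊗ id) ∘ ψ`. -/
  coassociative : ∀ m, comul.toLinearMap.rTensor M (coaction m) =
    coactionTensorId coaction (coaction m)

/-- The homomorphism `φ_{f, γ} : 𝕃B → A` given by `f` on `𝕃` that sends `b_i` to the coefficient
of `t^{i+1}` in `γ`. -/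
def evalLB {A : Type*} [CommRing A] (f : Lazard →+* A) (γ : PowerSeries A) :
    LB →ₐ[Lazard] Via f :=
  MvPolynomial.aeval fun n => Via.of f (PowerSeries.coeff (n + 2) γ)

end HopfAlgebroid

/-! ### `p`-typical formal group laws -/

section PTypical

variable {R S : Type*} [CommRing R] [CommRing S]

/-- The sum `a₁ +_F (a₂ +_F (⋯ +_F a_n))` of a list of power series. -/
def formalSum (F : FormalGroup R) (l : List (PowerSeries R)) : PowerSeries R :=
  l.foldr (fun a b => F.toPowerSeries.subst ![a, b]) 0

/-- The series `∑^F_{i < q} ζ^i t` over `R[ζ] = R[z]/(Φ_q(z))`, where `Φ_q` is the `q`-th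
cyclotomic polynomial. -/
def rootSum (F : FormalGroup R) (q : ℕ) :
    PowerSeries (AdjoinRoot (Polynomial.cyclotomic q R)) :=
  formalSum (F.map (AdjoinRoot.of (Polynomial.cyclotomic q R)))
    ((List.range q).map fun i =>
      PowerSeries.C (AdjoinRoot.root (Polynomial.cyclotomic q R) ^ i) * PowerSeries.X)

/-- A formal group law `F` over a `ℤ_(p)`-algebra is `p`-typical if `∑^F_{i < q} ζ^i t = 0` for
every prime `q ≠ p`, where `ζ` is a primitive `q`-th root of unity. Over a torsion-free
`ℤ_(p)`-algebra this says that the logarithm of `F` has the form `∑ l_i t^{p^i}`. -/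
def IsPTypical (p : ℕ) (F : FormalGroup R) : Prop :=
  ∀ q : ℕ, q.Prime → q ≠ p → rootSum F q = 0

/-- The ideal generated by the coordinates, in the `R`-basis `1, ζ, …, ζ^{q-2}` of `R[ζ]`, of the
coefficients of the series `∑^F_{i < q} ζ^i t`, for all primes `q ≠ p`. -/
def pTypicalIdeal (p : ℕ) (F : FormalGroup R) : Ideal R :=
  Ideal.span {a | ∃ q : ℕ, q.Prime ∧ q ≠ p ∧ ∃ n k : ℕ,
    a = (AdjoinRoot.modByMonicHom (Polynomial.cyclotomic.monic q R)
      (PowerSeries.coeff n (rootSum F q))).coeff k}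

theorem hasSubst_formalSum (F : FormalGroup R) {l : List (PowerSeries R)}
    (hl : ∀ a ∈ l, PowerSeries.HasSubst a) : PowerSeries.HasSubst (formalSum F l) := by
  induction l with
  | nil => exact PowerSeries.HasSubst.zero'
  | cons a l ih =>
    exact hasSubst_formalAdd F (hl a (by simp)) (ih fun b hb => hl b (by simp [hb]))

theorem map_formalSum (F : FormalGroup R) (φ : R →+* S) {l : List (PowerSeries R)}
    (hl : ∀ a ∈ l, PowerSeries.HasSubst a) :
    PowerSeries.map φ (formalSum F l) = formalSum (F.map φ) (l.map (PowerSeries.map φ)) := by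
  induction l with
  | nil => simp [formalSum]
  | cons a l ih =>
    have hl' : ∀ b ∈ l, PowerSeries.HasSubst b := fun b hb => hl b (by simp [hb])
    have h := MvPowerSeries.map_subst (h := φ)
      (hasSubst_pair (hl a (by simp)) (hasSubst_formalSum F hl')) F.toPowerSeries
    rw [map_pair] at h
    have ih' := ih hl'
    change MvPowerSeries.map φ (formalSum F l) = _ at ih'
    rw [ih'] at h
    exact h

/-- The map `R[ζ] → S[ζ]` induced by `φ : R → S`. -/
def cyclotomicMap (φ : R →+* S) (q : ℕ) :
    AdjoinRoot (Polynomial.cyclotomic q R) →+* AdjoinRoot (Polynomial.cyclotomic q S) :=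
  AdjoinRoot.map φ _ _ (by rw [Polynomial.map_cyclotomic])

theorem rootSum_map (F : FormalGroup R) (φ : R →+* S) (q : ℕ) :
    rootSum (F.map φ) q = PowerSeries.map (cyclotomicMap φ q) (rootSum F q) := by
  rw [rootSum, rootSum, map_formalSum]
  · congr 1
    · ext d
      simp [cyclotomicMap]
    · simp [cyclotomicMap, Function.comp_def]
  · intro a ha
    obtain ⟨i, -, rfl⟩ := List.mem_map.mp ha
    exact PowerSeries.HasSubst.of_constantCoeff_zero' (by simp)

theorem modByMonicHom_cyclotomicMap (φ : R →+* S) (q : ℕ)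
    (x : AdjoinRoot (Polynomial.cyclotomic q R)) :
    AdjoinRoot.modByMonicHom (Polynomial.cyclotomic.monic q S) (cyclotomicMap φ q x) =
      (AdjoinRoot.modByMonicHom (Polynomial.cyclotomic.monic q R) x).map φ := by
  induction x using AdjoinRoot.induction_on with
  | ih f =>
    have : cyclotomicMap φ q (AdjoinRoot.mk _ f) = AdjoinRoot.mk _ (f.map φ) := by
      rw [cyclotomicMap, AdjoinRoot.map, AdjoinRoot.lift_mk, ← Polynomial.eval₂_map,
        ← AdjoinRoot.aeval_eq, Polynomial.aeval_def, AdjoinRoot.algebraMap_eq]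
    rw [this, AdjoinRoot.modByMonicHom_mk, AdjoinRoot.modByMonicHom_mk,
      Polynomial.map_modByMonic _ (Polynomial.cyclotomic.monic q R), Polynomial.map_cyclotomic]

/-- The push-forward of `F` along `φ` is `p`-typical exactly if `φ` kills `pTypicalIdeal p F`. -/
theorem isPTypical_map_iff (p : ℕ) (F : FormalGroup R) (φ : R →+* S) :
    IsPTypical p (F.map φ) ↔ pTypicalIdeal p F ≤ RingHom.ker φ := by
  have key (q n : ℕ) : AdjoinRoot.modByMonicHom (Polynomial.cyclotomic.monic q S)
      (PowerSeries.coeff n (rootSum (F.map φ) q)) =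
      (AdjoinRoot.modByMonicHom (Polynomial.cyclotomic.monic q R)
        (PowerSeries.coeff n (rootSum F q))).map φ := by
    rw [rootSum_map, PowerSeries.coeff_map, modByMonicHom_cyclotomicMap]
  constructor
  · intro h
    refine Ideal.span_le.mpr ?_
    rintro _ ⟨q, hq, hqp, n, k, rfl⟩
    change φ _ = 0
    rw [← Polynomial.coeff_map, ← key, h q hq hqp]
    simp
  · intro h q hq hqp
    ext n
    apply (AdjoinRoot.mk_leftInverse (Polynomial.cyclotomic.monic q S)).injective
    rw [key, map_zero, map_zero]
    ext k
    rw [Polynomial.coeff_map, Polynomial.coeff_zero]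
    exact h (Ideal.subset_span ⟨q, hq, hqp, n, k, rfl⟩)

end PTypical

/-! ### The rings `𝕃_(p)` and `BP` -/

section BrownPeterson

variable (p : ℕ) [hp : Fact p.Prime]

/-- The multiplicative set of integers that are not divisible by `p`. -/
def primeTo : Submonoid ℤ where
  carrier := {n | ¬ (p : ℤ) ∣ n}
  one_mem' h := (Nat.prime_iff_prime_int.mp hp.out).not_isUnit (isUnit_of_dvd_one h)
  mul_mem' ha hb h := ((Nat.prime_iff_prime_int.mp hp.out).dvd_or_dvd h).elim ha hb

/-- The localization `𝕃_(p)` of the Lazard ring at `p`. -/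
abbrev LazardLoc : Type := Localization ((primeTo p).map (Int.castRingHom Lazard))

/-- The universal formal group law, regarded over `𝕃_(p)`. -/
def universalLoc : FormalGroup (LazardLoc p) :=
  universalFGL.map (algebraMap Lazard (LazardLoc p))

/-- The ring `BP` over which the universal `p`-typical formal group law is defined: the quotient
of `𝕃_(p)` by the relations that make the universal formal group law `p`-typical. -/
abbrev BP : Type := LazardLoc p ⧸ pTypicalIdeal p (universalLoc p)

/-- The universal `p`-typical formal group law; the map `𝕃 → BP` is the one that classifies it. -/
def universalPTypical : FormalGroup (BP p) := universalFGL.map (algebraMap Lazard (BP p))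

theorem universalPTypical_eq : universalPTypical p =
    (universalLoc p).map (Ideal.Quotient.mk (pTypicalIdeal p (universalLoc p))) := by
  ext d
  simp only [universalPTypical, universalLoc, FormalGroup.map_toPowerSeries,
    MvPowerSeries.coeff_map]
  rfl

theorem isPTypical_universalPTypical : IsPTypical p (universalPTypical p) := by
  rw [universalPTypical_eq, isPTypical_map_iff, Ideal.mk_ker]

/-- The universal property of `BP` among the rings in which every integer prime to `p` is
invertible. -/
theorem existsUnique_universalPTypical {A : Type*} [CommRing A]
    (hA : ∀ n : ℤ, ¬ (p : ℤ) ∣ n → IsUnit (n : A)) (F : FormalGroup A) [F.IsComm]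
    (hF : IsPTypical p F) : ∃! h : BP p →+* A, (universalPTypical p).map h = F := by
  have hu : ∀ y : (primeTo p).map (Int.castRingHom Lazard), IsUnit (classify F y) := by
    rintro ⟨_, n, hn, rfl⟩
    simpa using hA n hn
  let e : LazardLoc p →+* A := IsLocalization.lift hu
  have he : e.comp (algebraMap Lazard (LazardLoc p)) = classify F := IsLocalization.lift_comp hu
  have hmap : (universalLoc p).map e = F := by
    conv_rhs => rw [← map_classify F, ← he]
    ext d
    simp [universalLoc]
  have hker : pTypicalIdeal p (universalLoc p) ≤ RingHom.ker e := by
    rw [← isPTypical_map_iff, hmap]; exact hF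
  refine ⟨Ideal.Quotient.lift _ e fun a ha => RingHom.mem_ker.mp (hker ha), ?_, ?_⟩
  · dsimp only
    conv_rhs => rw [← hmap]
    rw [universalPTypical_eq]
    ext d
    simp
  · intro h hh
    refine Ideal.Quotient.ringHom_ext (IsLocalization.ringHom_ext
      ((primeTo p).map (Int.castRingHom Lazard)) (lazard_hom_ext ?_))
    rw [Ideal.Quotient.lift_comp_mk, he, map_classify]
    conv_rhs => rw [← hh]
    ext d
    simp only [universalPTypical, FormalGroup.map_toPowerSeries, MvPowerSeries.coeff_map]
    rfl

end BrownPeterson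

end LazardBP

end

open LazardBP

/-! A ring map `φ : LB → A` amounts to a law over `A`, classified by `f₂`, and a series `γ(t) = t +
⋯`. The composite of `φ` with the right unit then classifies the source of `γ`. So for a comodule
`M` the map `m ↦ (id ⊗ φ)(ψ(m))` is semilinear along `f₁` and extends `A`-linearly to `h_γ` on `M
⊗_{f₁} A`. Coassociativity gives `h_δ ∘ h_γ = h_{γ ∘ δ}` (`comparison_comp`), and the counit gives
`h_t = id` (`comparison_X`). Hence `h_γ` is invertible, with inverse given by the compositional
inverse of `γ`; it is unique because the elements `1 ⊗ m` generate. The second claim is the case `A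
= 𝕃_(p)`, with `f₁` the localization map and `f₂` the composite `𝕃 → BP → 𝕃_(p)`.

The first claim follows from Cartier's theorem: if all primes `q ≠ p` are invertible in `A`, every
commutative law `F` is strictly isomorphic to a `p`-typical one. The proof uses no logarithm and no
torsion-freeness. It builds a series `γ(t) = t + ⋯` with `∑^F_{i<q} γ(ζ^i t) = 0` for all `q ≠ p`,
one degree at a time. Suppose these sums vanish modulo `t^n`, and let `c_q` be the coefficient of
`t^n`. If `q ∤ n`, invariance under `t ↦ ζt` forces `c_q = 0` (`cyclotomicCoeff_eq_zero`). If `q ∣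
n`, adding `a t^n` to the series changes `c_q` by `q a`. That one `a ∈ A` serves all such `q`
follows because the sums for two primes commute, so that `r c_q = q c_r`
(`cyclotomicCoeff_compatible`). Transporting `F` along the limit series gives the `p`-typical law,
and the universal property of `BP` gives `g`. -/

noncomputable section

namespace LazardBP

/-! ### The groupoid of strict isomorphisms. -/

section StrictIso

variable {R S : Type*} [CommRing R] [CommRing S]

theorem constantCoeff_subst_series {γ δ : PowerSeries R} (hγ : PowerSeries.constantCoeff γ = 0)
    (hδ : PowerSeries.constantCoeff δ = 0) :
    PowerSeries.constantCoeff (γ.subst δ : PowerSeries R) = 0 :=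
  PowerSeries.constantCoeff_subst_eq_zero hδ _ hγ

theorem map_map_formalGroup {T : Type*} [CommRing T] (F : FormalGroup R) (f : R →+* S)
    (g : S →+* T) : (F.map f).map g = F.map (g.comp f) := by
  ext d
  simp

theorem subst_X_X (G : MvPowerSeries (Fin 2) R) :
    MvPowerSeries.subst ![(MvPowerSeries.X 0 : MvPowerSeries (Fin 2) R), MvPowerSeries.X 1] G =
      G := by
  have : (![MvPowerSeries.X 0, MvPowerSeries.X 1] : Fin 2 → MvPowerSeries (Fin 2) R) =
      MvPowerSeries.X := by
    ext1 i; fin_cases i <;> rfl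
  rw [this, MvPowerSeries.subst_self]; rfl

namespace IsStrictIso

variable {γ : PowerSeries R} {F₁ F₂ F₃ : FormalGroup R}

/-- Substituting `a`, `b` for the variables in the defining identity. In this form `γ` acts on
arbitrary arguments, which inverses, composites and the action on points all need. -/
theorem subst_formalAdd (h : IsStrictIso γ F₁ F₂) {σ : Type*} {a b : MvPowerSeries σ R}
    (ha : PowerSeries.HasSubst a) (hb : PowerSeries.HasSubst b) :
    γ.subst (F₂.toPowerSeries.subst ![a, b]) =
      F₁.toPowerSeries.subst ![γ.subst a, γ.subst b] := by
  have hc := hasSubst_pair ha hb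
  have hX (i : Fin 2) : PowerSeries.HasSubst (MvPowerSeries.X i : MvPowerSeries (Fin 2) R) :=
    PowerSeries.HasSubst.X i
  have hF : PowerSeries.HasSubst F₂.toPowerSeries :=
    PowerSeries.HasSubst.of_constantCoeff_zero F₂.zero_constantCoeff
  have key (i : Fin 2) : MvPowerSeries.subst ![a, b]
      (γ.subst (MvPowerSeries.X i : MvPowerSeries (Fin 2) R)) = γ.subst (![a, b] i) := by
    rw [PowerSeries.subst, MvPowerSeries.subst_comp_subst_apply (hX i).const hc,
      MvPowerSeries.subst_X hc]
    rfl
  have h' := congrArg (MvPowerSeries.subst ![a, b]) h.hom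
  rw [subst_pair_subst _ (hasSubst_subst h.constantCoeff_eq (hX 0))
    (hasSubst_subst h.constantCoeff_eq (hX 1)) hc, key, key, PowerSeries.subst,
    MvPowerSeries.subst_comp_subst_apply hF.const hc] at h'
  exact h'

theorem coeff_one_subst {γ δ : PowerSeries R} (hδ0 : PowerSeries.constantCoeff δ = 0)
    (hγ1 : PowerSeries.coeff 1 γ = 1) (hδ1 : PowerSeries.coeff 1 δ = 1) :
    PowerSeries.coeff 1 (γ.subst δ : PowerSeries R) = 1 := by
  rw [PowerSeries.coeff_subst' (PowerSeries.HasSubst.of_constantCoeff_zero' hδ0),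
    finsum_eq_single _ 1]
  · simp [hγ1, hδ1]
  · intro d hd
    rcases d with _ | _ | d
    · simp [PowerSeries.coeff_one]
    · exact absurd rfl hd
    -- `t ∣ δ`, so the powers of `δ` from the second on are divisible by `t²`.
    · have : PowerSeries.coeff 1 (δ ^ (d + 2)) = 0 :=
        PowerSeries.X_pow_dvd_iff.mp ((pow_dvd_pow _ (Nat.le_add_left 2 d)).trans
          (pow_dvd_pow_of_dvd (PowerSeries.X_dvd_iff.mpr hδ0) _)) 1 (by norm_num)
      rw [this, smul_zero]

theorem trans {δ : PowerSeries R} (h : IsStrictIso γ F₁ F₂) (h' : IsStrictIso δ F₂ F₃) :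
    IsStrictIso (γ.subst δ : PowerSeries R) F₁ F₃ where
  constantCoeff_eq := constantCoeff_subst_series h.constantCoeff_eq h'.constantCoeff_eq
  coeff_one_eq := coeff_one_subst h'.constantCoeff_eq h.coeff_one_eq h'.coeff_one_eq
  hom := by
    have hδ : PowerSeries.HasSubst δ :=
      PowerSeries.HasSubst.of_constantCoeff_zero' h'.constantCoeff_eq
    have hX (i : Fin 2) : PowerSeries.HasSubst (MvPowerSeries.X i : MvPowerSeries (Fin 2) R) :=
      PowerSeries.HasSubst.X i
    have hF : PowerSeries.HasSubst F₃.toPowerSeries :=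
      PowerSeries.HasSubst.of_constantCoeff_zero F₃.zero_constantCoeff
    rw [PowerSeries.subst_comp_subst_apply hδ hF, PowerSeries.subst_comp_subst_apply hδ (hX 0),
      PowerSeries.subst_comp_subst_apply hδ (hX 1), h'.hom,
      h.subst_formalAdd (hasSubst_subst h'.constantCoeff_eq (hX 0))
        (hasSubst_subst h'.constantCoeff_eq (hX 1))]

/-- Evaluate the identity for `γ` at `γ⁻¹(x)`, `γ⁻¹(y)` and apply `γ⁻¹` to both sides. -/
theorem symm (h : IsStrictIso γ F₁ F₂) :
    IsStrictIso (γ.substInvOfIsUnit (h.coeff_one_eq ▸ isUnit_one)) F₂ F₁ where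
  constantCoeff_eq := γ.constantCoeff_substInvOfIsUnit _
  coeff_one_eq := by
    rw [γ.coeff_one_substInvOfIsUnit, inv_eq_one.mpr (Units.ext h.coeff_one_eq)]
    rfl
  hom := by
    have hX (i : Fin 2) : PowerSeries.HasSubst (MvPowerSeries.X i : MvPowerSeries (Fin 2) R) :=
      PowerSeries.HasSubst.X i
    have hu : IsUnit (PowerSeries.coeff 1 γ) := h.coeff_one_eq ▸ isUnit_one
    have hY (i : Fin 2) := hasSubst_subst (γ.constantCoeff_substInvOfIsUnit hu) (hX i)
    have key := h.subst_formalAdd (hY 0) (hY 1)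
    rw [subst_substInv_subst h.constantCoeff_eq hu (hX 0),
      subst_substInv_subst h.constantCoeff_eq hu (hX 1), subst_X_X] at key
    rw [← key, substInv_subst_subst h.constantCoeff_eq hu (hasSubst_formalAdd F₂ (hY 0) (hY 1))]

/-- The source of a strict isomorphism is determined by the series and the target. -/
theorem left_unique {F₁' : FormalGroup R} (h : IsStrictIso γ F₁ F₂)
    (h' : IsStrictIso γ F₁' F₂) : F₁ = F₁' := by
  have hX (i : Fin 2) : PowerSeries.HasSubst (MvPowerSeries.X i : MvPowerSeries (Fin 2) R) :=
    PowerSeries.HasSubst.X i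
  have hu : IsUnit (PowerSeries.coeff 1 γ) := h.coeff_one_eq ▸ isUnit_one
  have hY (i : Fin 2) := hasSubst_subst (γ.constantCoeff_substInvOfIsUnit hu) (hX i)
  have key := (h.subst_formalAdd (hY 0) (hY 1)).symm.trans (h'.subst_formalAdd (hY 0) (hY 1))
  rw [subst_substInv_subst h.constantCoeff_eq hu (hX 0),
    subst_substInv_subst h.constantCoeff_eq hu (hX 1), subst_X_X, subst_X_X] at key
  exact FormalGroup.ext key

theorem map (h : IsStrictIso γ F₁ F₂) (f : R →+* S) :
    IsStrictIso (PowerSeries.map f γ) (F₁.map f) (F₂.map f) where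
  constantCoeff_eq := by
    rw [← PowerSeries.coeff_zero_eq_constantCoeff_apply, PowerSeries.coeff_map,
      PowerSeries.coeff_zero_eq_constantCoeff_apply, h.constantCoeff_eq, map_zero]
  coeff_one_eq := by rw [PowerSeries.coeff_map, h.coeff_one_eq, map_one]
  hom := by
    have hX (i : Fin 2) : PowerSeries.HasSubst (MvPowerSeries.X i : MvPowerSeries (Fin 2) R) :=
      PowerSeries.HasSubst.X i
    have hF : PowerSeries.HasSubst F₂.toPowerSeries :=
      PowerSeries.HasSubst.of_constantCoeff_zero F₂.zero_constantCoeff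
    have h' := congrArg (MvPowerSeries.map f) h.hom
    rw [MvPowerSeries.map_subst (hasSubst_pair (hasSubst_subst h.constantCoeff_eq (hX 0))
      (hasSubst_subst h.constantCoeff_eq (hX 1))), map_pair, PowerSeries.map_subst hF,
      PowerSeries.map_subst (hX 0), PowerSeries.map_subst (hX 1), MvPowerSeries.map_X,
      MvPowerSeries.map_X] at h'
    exact h'

end IsStrictIso

end StrictIso

/-! ### Base changes of a comodule along strictly isomorphic laws. -/

section Comparison

variable {A : Type*} [CommRing A] {M : Type*} [AddCommGroup M] [Module Lazard M]

/-- The homomorphism `evalLB f γ` as a map to the ring `A` itself. -/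
def evalRingHom (f : Lazard →+* A) (γ : PowerSeries A) : LB →+* A :=
  (evalLB f γ : LB →+* Via f)

theorem evalRingHom_algebraMap (f : Lazard →+* A) (γ : PowerSeries A) :
    (evalRingHom f γ).comp (algebraMap Lazard LB) = f :=
  RingHom.ext fun l => (evalLB f γ).commutes l

theorem evalRingHom_X (f : Lazard →+* A) (γ : PowerSeries A) (n : ℕ) :
    evalRingHom f γ (MvPolynomial.X n) = PowerSeries.coeff (n + 2) γ :=
  MvPolynomial.aeval_X (R := Lazard) (fun n => Via.of f (PowerSeries.coeff (n + 2) γ)) n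

/-- Universality of `gammaLN` among series `t + ⋯`: the two hypotheses cover the coefficients in
degrees 0 and 1, which no `b_i` controls. -/
theorem map_gammaLN (f : Lazard →+* A) {γ : PowerSeries A}
    (h0 : PowerSeries.constantCoeff γ = 0) (h1 : PowerSeries.coeff 1 γ = 1) :
    PowerSeries.map (evalRingHom f γ) gammaLN = γ := by
  ext n
  rw [PowerSeries.coeff_map, gammaLN, PowerSeries.coeff_mk]
  rcases n with _ | _ | n
  · rw [map_zero, PowerSeries.coeff_zero_eq_constantCoeff_apply, h0]
  · rw [map_one, h1]
  · exact evalRingHom_X f γ n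

/-- The generic twist pushes forward to a law that `γ` maps strictly to `(f₂)_* F`. Since `γ` and
its target determine the source, that law is `(f₁)_* F`. -/
theorem evalRingHom_rightUnit {f₁ f₂ : Lazard →+* A} {γ : PowerSeries A}
    (h : IsStrictIso γ (universalFGL.map f₁) (universalFGL.map f₂)) :
    (evalRingHom f₂ γ).comp rightUnit = f₁ := by
  refine lazard_hom_ext ?_
  have h' := (isStrictIso_twist (universalFGL.map (algebraMap Lazard LB)) gammaLN
    constantCoeff_gammaLN coeff_one_gammaLN).map (evalRingHom f₂ γ)
  rw [map_gammaLN f₂ h.constantCoeff_eq h.coeff_one_eq, map_map_formalGroup,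
    evalRingHom_algebraMap] at h'
  rw [← map_map_formalGroup, rightUnit, map_classify]
  exact h'.left_unique h

theorem evalLB_rTensor_smul (f : Lazard →+* A) (γ : PowerSeries A) (x : LB)
    (y : LB ⊗[Lazard] M) :
    (evalLB f γ).toLinearMap.rTensor M (x • y) =
      evalRingHom f γ x • (evalLB f γ).toLinearMap.rTensor M y := by
  induction y with
  | zero => simp
  | add y z hy hz => rw [smul_add, map_add, hy, hz, map_add, smul_add]
  | tmul a m =>
    rw [TensorProduct.smul_tmul', LinearMap.rTensor_tmul, LinearMap.rTensor_tmul,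
      TensorProduct.smul_tmul', smul_eq_mul]
    congr 1
    exact map_mul (evalLB f γ) x a

/-- The additive map underlying `comparison`. -/
def comparisonAddHom (C : Comodule M) {f₁ f₂ : Lazard →+* A} {γ : PowerSeries A}
    (h : IsStrictIso γ (universalFGL.map f₁) (universalFGL.map f₂)) :
    Via f₁ ⊗[Lazard] M →+ Via f₂ ⊗[Lazard] M :=
  TensorProduct.liftAddHom
    { toFun := fun a : Via f₁ =>
        { toFun := fun m => (show A from a) • (evalLB f₂ γ).toLinearMap.rTensor M (C.coaction m)
          map_zero' := by rw [map_zero, map_zero]; exact smul_zero (M := A) _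
          map_add' := fun m n => by rw [map_add, map_add]; exact smul_add (M := A) _ _ _ }
      map_zero' := by ext; exact zero_smul A _
      map_add' := fun x y => by ext; exact add_smul (R := A) _ _ _ }
    fun l a m => by
      change (f₁ l * (show A from a)) • (evalLB f₂ γ).toLinearMap.rTensor M (C.coaction m) =
        (show A from a) • (evalLB f₂ γ).toLinearMap.rTensor M (C.coaction (l • m))
      -- Balancedness over `𝕃`: a scalar leaves the coaction through the right unit, and `φ` turns
      -- it into `f₁ l`.
      rw [map_smulₛₗ C.coaction, evalLB_rTensor_smul, smul_smul, mul_comm (f₁ l),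
        ← evalRingHom_rightUnit h]
      rfl

/-- The `A`-linear map `M ⊗_{𝕃, f₁} A → M ⊗_{𝕃, f₂} A` that a strict isomorphism induces for a
comodule `M`. -/
def comparison (C : Comodule M) {f₁ f₂ : Lazard →+* A} {γ : PowerSeries A}
    (h : IsStrictIso γ (universalFGL.map f₁) (universalFGL.map f₂)) :
    Via f₁ ⊗[Lazard] M →ₗ[A] Via f₂ ⊗[Lazard] M where
  toFun := comparisonAddHom C h
  map_add' := map_add _
  map_smul' a x := by
    induction x with
    | zero => simp
    | add x y hx hy => rw [smul_add, map_add, map_add, hx, hy, smul_add]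
    | tmul b m => exact mul_smul a (show A from b) _

theorem comparison_tmul (C : Comodule M) {f₁ f₂ : Lazard →+* A} {γ : PowerSeries A}
    (h : IsStrictIso γ (universalFGL.map f₁) (universalFGL.map f₂)) (a : A) (m : M) :
    comparison C h (Via.of f₁ a ⊗ₜ[Lazard] m) =
      a • (evalLB f₂ γ).toLinearMap.rTensor M (C.coaction m) :=
  rfl

theorem comparison_one_tmul (C : Comodule M) {f₁ f₂ : Lazard →+* A} {γ : PowerSeries A}
    (h : IsStrictIso γ (universalFGL.map f₁) (universalFGL.map f₂)) (m : M) :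
    comparison C h (1 ⊗ₜ[Lazard] m) = (evalLB f₂ γ).toLinearMap.rTensor M (C.coaction m) :=
  one_smul A _

theorem via_linearMap_ext {N : Type*} [AddCommGroup N] [Module A N] {f : Lazard →+* A}
    {u v : Via f ⊗[Lazard] M →ₗ[A] N} (h : ∀ m, u (1 ⊗ₜ[Lazard] m) = v (1 ⊗ₜ[Lazard] m)) :
    u = v := by
  ext x
  induction x with
  | zero => simp
  | add x y hx hy => rw [map_add, map_add, hx, hy]
  | tmul b m =>
    have : b ⊗ₜ[Lazard] m = (show A from b) • ((1 : Via f) ⊗ₜ[Lazard] m) := by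
      rw [TensorProduct.smul_tmul']
      congr 1
      exact (mul_one (show A from b)).symm
    rw [this, map_smul, map_smul, h]

/-- The homomorphism `evalLB f₃ δ` as a homomorphism of algebras over `𝕃`, with respect to the
right unit. -/
def evalRight {f₂ f₃ : Lazard →+* A} {δ : PowerSeries A}
    (h : IsStrictIso δ (universalFGL.map f₂) (universalFGL.map f₃)) :
    -- The middle ring map `f₂` is the right unit side of `δ` and the left unit side of `γ`; this
    -- agreement lets the two maps be glued on the tensor product over `𝕃`.
    Via rightUnit →ₐ[Lazard] Via f₂ where
  __ := evalRingHom f₃ δ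
  commutes' l := congrArg (fun u => u l) (evalRingHom_rightUnit h)

/-- The homomorphism `𝕃B ⊗_𝕃 𝕃B → A` given by two composable strict isomorphisms: `δ` on the
first factor and `γ` on the second one. -/
def evalLB2 (γ : PowerSeries A) {f₂ f₃ : Lazard →+* A} {δ : PowerSeries A}
    (h : IsStrictIso δ (universalFGL.map f₂) (universalFGL.map f₃)) : LB2 →+* A :=
  (Algebra.TensorProduct.lift (evalRight h) (evalLB f₂ γ) (fun _ _ => Commute.all _ _)).toRingHom

section Composition

variable (γ : PowerSeries A) {f₂ f₃ : Lazard →+* A} {δ : PowerSeries A}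
  (h : IsStrictIso δ (universalFGL.map f₂) (universalFGL.map f₃))

theorem evalLB2_inl : (evalLB2 γ h).comp inl = evalRingHom f₃ δ :=
  RingHom.ext fun x => congrArg (fun u : Via rightUnit →ₐ[Lazard] Via f₂ => u (Via.of rightUnit x))
    (Algebra.TensorProduct.lift_comp_includeLeft (evalRight h) (evalLB f₂ γ)
      fun _ _ => Commute.all _ _)

theorem evalLB2_inr : (evalLB2 γ h).comp inr = evalRingHom f₂ γ :=
  RingHom.ext fun x => congrArg (fun u : LB →ₐ[Lazard] Via f₂ => u x)
    (Algebra.TensorProduct.lift_comp_includeRight (evalRight h) (evalLB f₂ γ)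
      fun _ _ => Commute.all _ _)

/-- `evalLB2` as a homomorphism of algebras over `𝕃`, with respect to the left units. -/
def evalLB2AlgHom : Via leftUnit2 →ₐ[Lazard] Via f₃ where
  __ := (Via.of f₃).comp (evalLB2 γ h)
  commutes' l := by
    change ((evalLB2 γ h).comp inl) (algebraMap Lazard LB l) = f₃ l
    rw [evalLB2_inl]
    exact (evalLB f₃ δ).commutes l

theorem evalLB2AlgHom_comp_inlAlgHom :
    (evalLB2AlgHom γ h).comp inlAlgHom = evalLB f₃ δ :=
  AlgHom.ext fun x => congrArg (fun u => u x) (evalLB2_inl γ h)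

/-- The comultiplication represents composition of strict isomorphisms: it sends the generic series
to `γ₂(γ₁(t))`, which specializes to `γ(δ(t))`. -/
theorem evalLB2AlgHom_comp_comul (hγ0 : PowerSeries.constantCoeff γ = 0)
    (hγ1 : PowerSeries.coeff 1 γ = 1) :
    (evalLB2AlgHom γ h).comp comul = evalLB f₃ (γ.subst δ : PowerSeries A) := by
  refine MvPolynomial.algHom_ext fun n => ?_
  rw [AlgHom.comp_apply, comul, MvPolynomial.aeval_X, evalLB, MvPolynomial.aeval_X]
  change evalLB2 γ h (PowerSeries.coeff (n + 2)
      ((PowerSeries.map inr gammaLN).subst (PowerSeries.map inl gammaLN) : PowerSeries LB2)) =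
    PowerSeries.coeff (n + 2) (γ.subst δ : PowerSeries A)
  have hinl : PowerSeries.HasSubst (PowerSeries.map inl gammaLN) := by
    refine PowerSeries.HasSubst.of_constantCoeff_zero' ?_
    rw [← PowerSeries.coeff_zero_eq_constantCoeff_apply, PowerSeries.coeff_map,
      PowerSeries.coeff_zero_eq_constantCoeff_apply, constantCoeff_gammaLN, map_zero]
  rw [← PowerSeries.coeff_map]
  congr 1
  refine (PowerSeries.map_subst hinl _).trans ?_
  have e1 : PowerSeries.map (evalLB2 γ h) (PowerSeries.map inr gammaLN) = γ := by
    rw [← RingHom.comp_apply, ← PowerSeries.map_comp, evalLB2_inr, map_gammaLN _ hγ0 hγ1]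
  have e2 : PowerSeries.map (evalLB2 γ h) (PowerSeries.map inl gammaLN) = δ := by
    rw [← RingHom.comp_apply, ← PowerSeries.map_comp, evalLB2_inl,
      map_gammaLN _ h.constantCoeff_eq h.coeff_one_eq]
  rw [e1]
  exact congrArg (fun x => PowerSeries.subst x γ) e2

theorem evalLB2AlgHom_rTensor_smul (x : LB2) (y : Via leftUnit2 ⊗[Lazard] M) :
    (evalLB2AlgHom γ h).toLinearMap.rTensor M (x • y) =
      evalLB2 γ h x • (evalLB2AlgHom γ h).toLinearMap.rTensor M y := by
  induction y with
  | zero => rw [smul_zero, map_zero, smul_zero]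
  | add y z hy hz => rw [smul_add, map_add, hy, hz, map_add, smul_add]
  | tmul a m =>
    rw [TensorProduct.smul_tmul', LinearMap.rTensor_tmul, LinearMap.rTensor_tmul,
      TensorProduct.smul_tmul']
    congr 1
    exact map_mul (evalLB2 γ h) x a

end Composition

theorem comparison_comp (C : Comodule M) {f₁ f₂ f₃ : Lazard →+* A} {γ δ : PowerSeries A}
    (h : IsStrictIso γ (universalFGL.map f₁) (universalFGL.map f₂))
    (h' : IsStrictIso δ (universalFGL.map f₂) (universalFGL.map f₃)) :
    comparison C h' ∘ₗ comparison C h = comparison C (h.trans h') := by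
  refine via_linearMap_ext fun m => ?_
  rw [LinearMap.comp_apply, comparison_one_tmul, comparison_one_tmul,
    ← evalLB2AlgHom_comp_comul γ h' h.constantCoeff_eq h.coeff_one_eq, AlgHom.comp_toLinearMap,
    LinearMap.rTensor_comp_apply, C.coassociative]
  -- Coassociativity has been used, and what remains is an identity on all of `M ⊗_𝕃 𝕃B`, so pure
  -- tensors suffice.
  generalize C.coaction m = y
  induction y with
  | zero => simp
  | add y z hy hz => rw [map_add, map_add, map_add, map_add, hy, hz]
  | tmul x m =>
    have e : coactionTensorId C.coaction (x ⊗ₜ[Lazard] m) =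
      inr x • inlAlgHom.toLinearMap.rTensor M (C.coaction m) := rfl
    rw [e, evalLB2AlgHom_rTensor_smul, ← LinearMap.rTensor_comp_apply,
      ← AlgHom.comp_toLinearMap, evalLB2AlgHom_comp_inlAlgHom, LinearMap.rTensor_tmul,
      ← RingHom.comp_apply, evalLB2_inr]
    exact comparison_tmul C h' _ m

theorem comparison_X (C : Comodule M) {f : Lazard →+* A}
    (h : IsStrictIso (PowerSeries.X : PowerSeries A) (universalFGL.map f) (universalFGL.map f)) :
    comparison C h = LinearMap.id := by
  refine via_linearMap_ext fun m => ?_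
  -- The series `t` has no terms of degree at least 2, so every `b_i` goes to 0 and the evaluation
  -- factors through the counit.
  have e : evalLB f (PowerSeries.X : PowerSeries A) = (Algebra.ofId Lazard (Via f)).comp counit := by
    refine MvPolynomial.algHom_ext fun n => ?_
    rw [evalLB, MvPolynomial.aeval_X, AlgHom.comp_apply, counit, MvPolynomial.aeval_X, map_zero,
      PowerSeries.coeff_X, if_neg (by omega), map_zero]
  rw [comparison_one_tmul, e, AlgHom.comp_toLinearMap, LinearMap.rTensor_comp_apply]
  conv_rhs => rw [← C.counital m]
  generalize counit.toLinearMap.rTensor M (C.coaction m) = y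
  induction y with
  | zero => simp
  | add y z hy hz => rw [map_add, hy, hz, map_add, ← map_add, TensorProduct.tmul_add, map_add]
  | tmul l m =>
    rw [LinearMap.rTensor_tmul, TensorProduct.lid_tmul, TensorProduct.tmul_smul,
      TensorProduct.smul_tmul', Algebra.smul_def, mul_one]
    rfl

theorem comparison_comp_eq_id (C : Comodule M) {f₁ f₂ : Lazard →+* A} {γ δ : PowerSeries A}
    (h : IsStrictIso γ (universalFGL.map f₁) (universalFGL.map f₂))
    (h' : IsStrictIso δ (universalFGL.map f₂) (universalFGL.map f₁))
    (e : (γ.subst δ : PowerSeries A) = PowerSeries.X) :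
    comparison C h' ∘ₗ comparison C h = LinearMap.id := by
  rw [comparison_comp]
  -- The series occurs in the type of the strict isomorphism, so it is made a variable before being
  -- replaced by `t`.
  have : ∀ (ε : PowerSeries A) (k : IsStrictIso ε (universalFGL.map f₁) (universalFGL.map f₁)),
      ε = PowerSeries.X → comparison C k = LinearMap.id := by
    rintro ε k rfl
    exact comparison_X C k
  exact this _ _ e

/-- The isomorphism `M ⊗_{𝕃, f₁} A ≃ M ⊗_{𝕃, f₂} A` that a strict isomorphism induces for a
comodule `M`. -/
def comparisonEquiv (C : Comodule M) {f₁ f₂ : Lazard →+* A} {γ : PowerSeries A}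
    (h : IsStrictIso γ (universalFGL.map f₁) (universalFGL.map f₂)) :
    (Via f₁ ⊗[Lazard] M) ≃ₗ[A] (Via f₂ ⊗[Lazard] M) :=
  LinearEquiv.ofLinearMap (comparison C h) (comparison C h.symm)
    (comparison_comp_eq_id C h.symm h (γ.subst_substInvOfIsUnit_left h.constantCoeff_eq _))
    (comparison_comp_eq_id C h h.symm (γ.subst_substInvOfIsUnit_right h.constantCoeff_eq _))

theorem existsUnique_comparison (C : Comodule M) {f₁ f₂ : Lazard →+* A} {γ : PowerSeries A}
    (h : IsStrictIso γ (universalFGL.map f₁) (universalFGL.map f₂)) :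
    ∃! e : (Via f₁ ⊗[Lazard] M) ≃ₗ[A] (Via f₂ ⊗[Lazard] M),
      ∀ m : M, e (1 ⊗ₜ[Lazard] m) = (evalLB f₂ γ).toLinearMap.rTensor M (C.coaction m) := by
  refine ⟨comparisonEquiv C h, comparison_one_tmul C h, fun e he => ?_⟩
  refine LinearEquiv.toLinearMap_injective (via_linearMap_ext fun m => ?_)
  exact (he m).trans (comparison_one_tmul C h m).symm

/-- The base change along `algebraMap` in terms of `Via`. -/
def viaAlgebraMapEquiv [Algebra Lazard A] :
    (A ⊗[Lazard] M) ≃ₗ[A] (Via (algebraMap Lazard A) ⊗[Lazard] M) :=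
  haveI : IsScalarTower Lazard A (Via (algebraMap Lazard A)) :=
    ⟨fun l a x => by
      change (l • a) * (show A from x) = algebraMap Lazard A l * (a * (show A from x))
      rw [Algebra.smul_def, mul_assoc]⟩
  TensorProduct.AlgebraTensorModule.congr
    (show A ≃ₗ[A] Via (algebraMap Lazard A) from LinearEquiv.refl A A) (LinearEquiv.refl Lazard M)

/-- Transitivity of base change in terms of `Via`. -/
def viaCompEquiv {B : Type*} [CommRing B] [Algebra Lazard B] (g : B →+* A) :
    (Via g ⊗[B] (B ⊗[Lazard] M)) ≃ₗ[A] (Via (g.comp (algebraMap Lazard B)) ⊗[Lazard] M) :=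
  letI : Algebra Lazard (Via g) := (g.comp (algebraMap Lazard B)).toAlgebra
  haveI : IsScalarTower Lazard B (Via g) := IsScalarTower.of_algebraMap_eq fun _ => rfl
  letI : Algebra B A := g.toAlgebra
  letI : Algebra Lazard A := (g.comp (algebraMap Lazard B)).toAlgebra
  haveI : IsScalarTower B A (Via g) := ⟨fun b a x => mul_assoc (g b) a (show A from x)⟩
  haveI : IsScalarTower Lazard A (Via g) :=
    ⟨fun l a x => mul_assoc (g (algebraMap Lazard B l)) a (show A from x)⟩
  TensorProduct.AlgebraTensorModule.cancelBaseChange Lazard B A (Via g) M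

end Comparison

theorem nonempty_equiv_of_strictlyIsomorphic (p : ℕ) [Fact p.Prime]
    {M : Type*} [AddCommGroup M] [Module Lazard M] (C : Comodule M) (g : BP p →+* LazardLoc p)
    (h : StrictlyIsomorphic (universalLoc p) ((universalPTypical p).map g)) :
    Nonempty ((LazardLoc p ⊗[Lazard] M) ≃ₗ[LazardLoc p]
      (Via g ⊗[BP p] (BP p ⊗[Lazard] M))) := by
  obtain ⟨γ, hγ⟩ := h
  change IsStrictIso γ (universalFGL.map _) ((universalFGL.map _).map g) at hγ
  -- The target law is now `F_𝕃` pushed forward along `𝕃 → BP → 𝕃_(p)`, so the comparison applies;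
  -- transitivity of base change does the rest.
  rw [map_map_formalGroup] at hγ
  exact ⟨viaAlgebraMapEquiv ≪≫ₗ comparisonEquiv C hγ ≪≫ₗ (viaCompEquiv g).symm⟩

/-! ### Power series in one variable under formal addition, with their `t`-adic filtration. -/

section Points

variable {R S : Type*} [CommRing R] [CommRing S]

theorem coeff_formalAdd_eq_finsum (G : MvPowerSeries (Fin 2) R) {x y : PowerSeries R}
    (hx : PowerSeries.HasSubst x) (hy : PowerSeries.HasSubst y) (n : ℕ) :
    PowerSeries.coeff n (G.subst ![x, y] : PowerSeries R) =
      ∑ᶠ d : Fin 2 →₀ ℕ, MvPowerSeries.coeff d G * PowerSeries.coeff n (x ^ d 0 * y ^ d 1) := by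
  rw [PowerSeries.coeff, MvPowerSeries.coeff_subst (hasSubst_pair hx hy)]
  refine finsum_congr fun d => ?_
  rw [smul_eq_mul, Finsupp.prod_fintype _ _ fun _ => pow_zero _, Fin.prod_univ_two]
  rfl

/-- Formal addition respects congruence modulo powers of the variable. -/
theorem X_pow_dvd_formalAdd_sub (G : MvPowerSeries (Fin 2) R) {x x' y y' : PowerSeries R}
    (hx : PowerSeries.HasSubst x) (hx' : PowerSeries.HasSubst x') (hy : PowerSeries.HasSubst y)
    (hy' : PowerSeries.HasSubst y') {n : ℕ} (hxx : PowerSeries.X ^ n ∣ x - x')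
    (hyy : PowerSeries.X ^ n ∣ y - y') :
    PowerSeries.X ^ n ∣ (G.subst ![x, y] - G.subst ![x', y'] : PowerSeries R) := by
  rw [PowerSeries.X_pow_dvd_iff]
  intro m hm
  rw [map_sub, sub_eq_zero, coeff_formalAdd_eq_finsum G hx hy, coeff_formalAdd_eq_finsum G hx' hy']
  refine finsum_congr fun d => ?_
  congr 1
  rw [← sub_eq_zero, ← map_sub]
  refine PowerSeries.X_pow_dvd_iff.mp ?_ m hm
  have e : x ^ d 0 * y ^ d 1 - x' ^ d 0 * y' ^ d 1 =
      (x ^ d 0 - x' ^ d 0) * y ^ d 1 + x' ^ d 0 * (y ^ d 1 - y' ^ d 1) := by ring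
  rw [e]
  exact dvd_add ((hxx.trans (sub_dvd_pow_sub_pow _ _ _)).mul_right _)
    ((hyy.trans (sub_dvd_pow_sub_pow _ _ _)).mul_left _)

/-- Formal addition agrees with addition on leading coefficients. -/
theorem coeff_formalAdd_of_X_pow_dvd (F : FormalGroup R) {x y : PowerSeries R} {n : ℕ}
    (hn : 1 ≤ n) (hx : PowerSeries.X ^ n ∣ x) (hy : PowerSeries.X ^ n ∣ y) :
    PowerSeries.coeff n (F.toPowerSeries.subst ![x, y] : PowerSeries R) =
      PowerSeries.coeff n x + PowerSeries.coeff n y := by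
  have hs {z : PowerSeries R} (hz : PowerSeries.X ^ n ∣ z) : PowerSeries.HasSubst z :=
    PowerSeries.HasSubst.of_constantCoeff_zero'
      (PowerSeries.X_dvd_iff.mp ((dvd_pow_self _ (by omega)).trans hz))
  rw [coeff_formalAdd_eq_finsum _ (hs hx) (hs hy),
    finsum_eq_sum_of_support_subset (s := {Finsupp.single 0 1, Finsupp.single 1 1}),
    Finset.sum_pair]
  · simp [F.lin_coeff_X, F.lin_coeff_Y]
  · intro h
    simpa using DFunLike.congr_fun h 0
  · intro d hd
    by_contra hd'
    refine hd ?_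
    simp only [Finset.coe_insert, Finset.coe_singleton, Set.mem_insert_iff,
      Set.mem_singleton_iff, not_or] at hd'
    -- A monomial of total degree at least 2 in `x`, `y` is divisible by `t^(2n)`, and `n < 2n`
    -- because `n ≥ 1`. Only the linear terms survive.
    by_cases h2 : 2 ≤ d 0 + d 1
    · have : PowerSeries.X ^ (n * 2) ∣ x ^ d 0 * y ^ d 1 := by
        refine (pow_dvd_pow _ (Nat.mul_le_mul_left n h2)).trans ?_
        rw [mul_add, pow_add, pow_mul, pow_mul]
        exact mul_dvd_mul (pow_dvd_pow_of_dvd hx _) (pow_dvd_pow_of_dvd hy _)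
      exact mul_eq_zero_of_right _ (PowerSeries.X_pow_dvd_iff.mp this n (by omega))
    · have h0 : d = 0 := by
        by_contra hne
        rcases Nat.eq_zero_or_pos (d 0) with h | h
        · refine hd'.2 (Finsupp.ext fun i => ?_)
          have : d 1 ≠ 0 := fun h1 => hne (Finsupp.ext fun i => by fin_cases i <;> simp [h, h1])
          fin_cases i <;> simp <;> omega
        · exact hd'.1 (Finsupp.ext fun i => by fin_cases i <;> simp <;> omega)
      rw [h0]
      have := F.zero_constantCoeff
      rw [← MvPowerSeries.coeff_zero_eq_constantCoeff_apply] at this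
      exact mul_eq_zero_of_left this _

theorem rescale_eq_mvSubst (u : R) (x : PowerSeries R) : PowerSeries.rescale u x =
    MvPowerSeries.subst (fun _ : Unit => (u • PowerSeries.X : PowerSeries R)) x :=
  PowerSeries.rescale_eq_subst u x

/-- The additive map `x(t) ↦ x(ut)` on the points of a formal group law. -/
def rescalePoint (G : FormalGroup R) (u : R) : G.Point Unit →+ G.Point Unit where
  toFun x := ⟨PowerSeries.rescale u (x.val : PowerSeries R), by
    rw [rescale_eq_mvSubst]
    exact MvPowerSeries.IsNilpotent_subst (PowerSeries.HasSubst.smul_X' u).const x.prop⟩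
  map_zero' := Subtype.ext (map_zero (PowerSeries.rescale u))
  map_add' x y := Subtype.ext <| by
    change PowerSeries.rescale u (G.toPowerSeries.subst ![x.val, y.val] : PowerSeries R) =
      G.toPowerSeries.subst ![(PowerSeries.rescale u (x.val : PowerSeries R) : PowerSeries R),
        PowerSeries.rescale u (y.val : PowerSeries R)]
    rw [rescale_eq_mvSubst, rescale_eq_mvSubst, rescale_eq_mvSubst]
    exact subst_pair_subst _ x.prop y.prop (PowerSeries.HasSubst.smul_X' u).const

theorem rescalePoint_val (G : FormalGroup R) (u : R) (x : G.Point Unit) :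
    ((rescalePoint G u x).val : PowerSeries R) = PowerSeries.rescale u (x.val : PowerSeries R) :=
  rfl

theorem rescalePoint_rescalePoint (G : FormalGroup R) (u v : R) (x : G.Point Unit) :
    rescalePoint G u (rescalePoint G v x) = rescalePoint G (v * u) x :=
  Subtype.ext (PowerSeries.rescale_rescale _ _ _)

theorem rescalePoint_comm (G : FormalGroup R) (u v : R) (x : G.Point Unit) :
    rescalePoint G u (rescalePoint G v x) = rescalePoint G v (rescalePoint G u x) := by
  rw [rescalePoint_rescalePoint, rescalePoint_rescalePoint, mul_comm]

/-- The additive map that a ring homomorphism induces on the points of a formal group law. -/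
def mapPoint {G : FormalGroup R} {H : FormalGroup S} (f : R →+* S) (hf : G.map f = H) :
    G.Point Unit →+ H.Point Unit where
  toFun x := ⟨PowerSeries.map f (x.val : PowerSeries R), by
    have h : MvPowerSeries.constantCoeff (MvPowerSeries.map f x.val) =
      f (MvPowerSeries.constantCoeff x.val) := MvPowerSeries.constantCoeff_map f x.val
    exact (congrArg IsNilpotent h).mpr (x.prop.map f)⟩
  map_zero' := Subtype.ext (map_zero (PowerSeries.map f))
  map_add' x y := Subtype.ext <| by
    subst hf
    change MvPowerSeries.map f (G.toPowerSeries.subst ![x.val, y.val]) = _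
    rw [MvPowerSeries.map_subst (hasSubst_pair x.prop y.prop), map_pair]
    rfl

theorem mapPoint_val {G : FormalGroup R} {H : FormalGroup S} (f : R →+* S) (hf : G.map f = H)
    (x : G.Point Unit) :
    ((mapPoint f hf x).val : PowerSeries S) = PowerSeries.map f (x.val : PowerSeries R) :=
  rfl

theorem mapPoint_rescalePoint {G : FormalGroup R} {H : FormalGroup S} (f : R →+* S)
    (hf : G.map f = H) (u : R) (x : G.Point Unit) :
    mapPoint f hf (rescalePoint G u x) = rescalePoint H (f u) (mapPoint f hf x) :=
  Subtype.ext <| PowerSeries.ext fun n => by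
    rw [mapPoint_val, rescalePoint_val, rescalePoint_val, mapPoint_val, PowerSeries.coeff_map,
      PowerSeries.coeff_rescale, PowerSeries.coeff_rescale, PowerSeries.coeff_map, map_mul, map_pow]

theorem X_pow_dvd_map (f : R →+* S) {x : PowerSeries R} {n : ℕ} (hx : PowerSeries.X ^ n ∣ x) :
    PowerSeries.X ^ n ∣ PowerSeries.map f x := by
  simpa using map_dvd (PowerSeries.map f) hx

theorem X_pow_dvd_rescale (u : R) {x : PowerSeries R} {n : ℕ} (hx : PowerSeries.X ^ n ∣ x) :
    PowerSeries.X ^ n ∣ PowerSeries.rescale u x :=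
  PowerSeries.X_pow_dvd_iff.mpr fun m hm => by
    rw [PowerSeries.coeff_rescale, PowerSeries.X_pow_dvd_iff.mp hx m hm, mul_zero]

theorem X_pow_succ_dvd {x : PowerSeries R} {n : ℕ} (hx : PowerSeries.X ^ n ∣ x)
    (h : PowerSeries.coeff n x = 0) : PowerSeries.X ^ (n + 1) ∣ x :=
  PowerSeries.X_pow_dvd_iff.mpr fun m hm => by
    rcases Nat.lt_succ_iff_lt_or_eq.mp hm with hm | rfl
    · exact PowerSeries.X_pow_dvd_iff.mp hx m hm
    · exact h

/-- The points that are congruent to `0` modulo `t^n`. -/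
def pointFiltration (G : FormalGroup R) (n : ℕ) : AddSubmonoid (G.Point Unit) where
  carrier := {x | PowerSeries.X ^ n ∣ (x.val : PowerSeries R)}
  zero_mem' := dvd_zero _
  add_mem' {x y} hx hy := by
    have h0 : PowerSeries.HasSubst (0 : PowerSeries R) := PowerSeries.HasSubst.zero'
    have h := X_pow_dvd_formalAdd_sub G.toPowerSeries (n := n) x.prop h0 y.prop h0
      ((sub_zero (x.val : PowerSeries R)).symm ▸ hx) ((sub_zero (y.val : PowerSeries R)).symm ▸ hy)
    rw [G.add_zero h0, sub_zero] at h
    exact h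

theorem coeff_add_of_mem {G : FormalGroup R} {n : ℕ} (hn : 1 ≤ n) {x y : G.Point Unit}
    (hx : x ∈ pointFiltration G n) (hy : y ∈ pointFiltration G n) :
    PowerSeries.coeff n ((x + y).val : PowerSeries R) =
      PowerSeries.coeff n (x.val : PowerSeries R) + PowerSeries.coeff n (y.val : PowerSeries R) :=
  coeff_formalAdd_of_X_pow_dvd G hn hx hy

/-- The point `a t^n`. -/
def pointMonomial (F : FormalGroup R) (a : R) {n : ℕ} (hn : 1 ≤ n) : F.Point Unit :=
  ⟨PowerSeries.C a * PowerSeries.X ^ n, PowerSeries.HasSubst.of_constantCoeff_zero' <| by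
    rw [map_mul, map_pow, PowerSeries.constantCoeff_X, zero_pow (by omega), mul_zero]⟩

theorem pointMonomial_mem {F : FormalGroup R} (a : R) {n : ℕ} (hn : 1 ≤ n) :
    pointMonomial F a hn ∈ pointFiltration F n :=
  dvd_mul_left _ _

instance isCommMap (G : FormalGroup R) [G.IsComm] (f : R →+* S) : (G.map f).IsComm :=
  isComm_map G f

/-! ### Sums over the substitutions `t ↦ u^i t`. -/

section RescaleSum

variable (G : FormalGroup R) [G.IsComm]

/-- The additive map `x(t) ↦ ∑^G_{i < q} x(u^i t)` on the points of a formal group law. -/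
def rescaleSum (q : ℕ) (u : R) : G.Point Unit →+ G.Point Unit :=
  ∑ i ∈ Finset.range q, rescalePoint G (u ^ i)

theorem rescaleSum_apply (q : ℕ) (u : R) (x : G.Point Unit) :
    rescaleSum G q u x = ∑ i ∈ Finset.range q, rescalePoint G (u ^ i) x :=
  AddMonoidHom.finsetSum_apply _ _ _

variable {G}

/-- Rescalings are additive and commute with one another. Applied to roots of unity of two prime
orders, this is what ties the obstructions for the two primes together. -/
theorem rescaleSum_comm (q r : ℕ) (u v : R) (x : G.Point Unit) :
    rescaleSum G q u (rescaleSum G r v x) = rescaleSum G r v (rescaleSum G q u x) := by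
  simp only [rescaleSum_apply, map_sum]
  rw [Finset.sum_comm]
  simp only [rescalePoint_comm G (u ^ _)]

theorem mapPoint_rescaleSum {H : FormalGroup S} [H.IsComm] (f : R →+* S)
    (hf : G.map f = H) (q : ℕ) (u : R) (x : G.Point Unit) :
    mapPoint f hf (rescaleSum G q u x) = rescaleSum H q (f u) (mapPoint f hf x) := by
  simp only [rescaleSum_apply, map_sum, mapPoint_rescalePoint, map_pow]

theorem rescaleSum_mem {n : ℕ} (q : ℕ) (u : R) {x : G.Point Unit}
    (hx : x ∈ pointFiltration G n) : rescaleSum G q u x ∈ pointFiltration G n := by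
  rw [rescaleSum_apply]
  exact sum_mem fun i _ => X_pow_dvd_rescale _ hx

/-- Formal addition is ordinary addition on leading coefficients, and `t ↦ u^i t` multiplies the
coefficient of `t^n` by `u^(in)`. -/
theorem coeff_rescaleSum {n : ℕ} (hn : 1 ≤ n) (q : ℕ) (u : R) {x : G.Point Unit}
    (hx : x ∈ pointFiltration G n) :
    PowerSeries.coeff n ((rescaleSum G q u x).val : PowerSeries R) =
      (∑ i ∈ Finset.range q, (u ^ i) ^ n) * PowerSeries.coeff n (x.val : PowerSeries R) := by
  rw [rescaleSum_apply]
  induction q with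
  | zero =>
    rw [Finset.sum_range_zero, Finset.sum_range_zero, zero_mul]
    exact map_zero (PowerSeries.coeff n)
  | succ q ih =>
    rw [Finset.sum_range_succ, Finset.sum_range_succ, coeff_add_of_mem hn
      ((pointFiltration G n).sum_mem fun i _ => X_pow_dvd_rescale _ hx) (X_pow_dvd_rescale _ hx), ih,
      add_mul, rescalePoint_val, PowerSeries.coeff_rescale]

/-- Continuity in the `t`-adic topology, needed to pass from the approximations to their limit. -/
theorem X_pow_dvd_rescaleSum_sub {n : ℕ} (q : ℕ) (u : R) {x y : G.Point Unit}
    (h : PowerSeries.X ^ n ∣ (x.val - y.val : PowerSeries R)) :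
    PowerSeries.X ^ n ∣
      ((rescaleSum G q u x).val - (rescaleSum G q u y).val : PowerSeries R) := by
  rw [rescaleSum_apply, rescaleSum_apply]
  induction q with
  | zero => rw [Finset.sum_range_zero, Finset.sum_range_zero, sub_self]; exact dvd_zero _
  | succ q ih =>
    rw [Finset.sum_range_succ, Finset.sum_range_succ]
    refine X_pow_dvd_formalAdd_sub G.toPowerSeries (Subtype.prop _) (Subtype.prop _)
      (Subtype.prop _) (Subtype.prop _) ih ?_
    rw [rescalePoint_val, rescalePoint_val, ← map_sub]
    exact X_pow_dvd_rescale _ h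

theorem rescalePoint_rescaleSum {q : ℕ} (hq : 1 ≤ q) {u : R} (hu : u ^ q = 1) (x : G.Point Unit) :
    rescalePoint G u (rescaleSum G q u x) = rescaleSum G q u x := by
  obtain ⟨q, rfl⟩ : ∃ k, q = k + 1 := ⟨q - 1, by omega⟩
  simp only [rescaleSum_apply, map_sum, rescalePoint_rescalePoint, ← pow_succ]
  -- Rescaling by `u` shifts the summands cyclically: the last one, with factor `u^q = 1`, becomes
  -- the one with factor `u^0`.
  rw [Finset.sum_range_succ, Finset.sum_range_succ' (fun i => rescalePoint G (u ^ i) x), hu,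
    pow_zero]

end RescaleSum

theorem formalSum_eq_val_sum (G : FormalGroup R) {ι : Type*} (l : List ι) (x : ι → G.Point Unit) :
    formalSum G (l.map fun i => ((x i).val : PowerSeries R)) = (l.map x).sum.val := by
  induction l with
  | nil => rfl
  | cons i l ih =>
    rw [List.map_cons, List.map_cons, List.sum_cons, G.add_apply, ← ih]
    rfl

/-- The coordinate `t` as a point. -/
def pointX (G : FormalGroup R) : G.Point Unit := ⟨PowerSeries.X, PowerSeries.HasSubst.X'⟩

theorem formalSum_eq_rescaleSum (G : FormalGroup R) [G.IsComm] (q : ℕ) (u : R) :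
    formalSum G ((List.range q).map fun i => PowerSeries.C (u ^ i) * PowerSeries.X) =
      (rescaleSum G q u (pointX G)).val := by
  have h (i : ℕ) : (PowerSeries.C (u ^ i) * PowerSeries.X : PowerSeries R) =
      (rescalePoint G (u ^ i) (pointX G)).val := by
    rw [rescalePoint_val]
    exact (PowerSeries.rescale_X _).symm
  simp only [h]
  rw [formalSum_eq_val_sum, rescaleSum_apply]
  rfl

/-- The additive map on points that a strict isomorphism induces. -/
def IsStrictIso.pointHom {γ : PowerSeries R} {F₁ F₂ : FormalGroup R} (h : IsStrictIso γ F₁ F₂) :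
    F₂.Point Unit →+ F₁.Point Unit where
  toFun x := ⟨γ.subst x.val, hasSubst_subst h.constantCoeff_eq x.prop⟩
  map_zero' := Subtype.ext (subst_zero_eq h.constantCoeff_eq)
  map_add' x y := Subtype.ext (h.subst_formalAdd x.prop y.prop)

theorem IsStrictIso.pointHom_injective {γ : PowerSeries R} {F₁ F₂ : FormalGroup R}
    (h : IsStrictIso γ F₁ F₂) : Function.Injective h.pointHom := fun x y hxy => by
  have e : γ.subst x.val = γ.subst y.val := congrArg Subtype.val hxy
  have hu : IsUnit (PowerSeries.coeff 1 γ) := h.coeff_one_eq ▸ isUnit_one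
  refine Subtype.ext ?_
  rw [← substInv_subst_subst h.constantCoeff_eq hu x.prop, e,
    substInv_subst_subst h.constantCoeff_eq hu y.prop]

theorem IsStrictIso.pointHom_rescalePoint {γ : PowerSeries R} {F₁ F₂ : FormalGroup R}
    (h : IsStrictIso γ F₁ F₂) (u : R) (x : F₂.Point Unit) :
    h.pointHom (rescalePoint F₂ u x) = rescalePoint F₁ u (h.pointHom x) := by
  refine Subtype.ext ?_
  change γ.subst (PowerSeries.rescale u (x.val : PowerSeries R)) =
    PowerSeries.rescale u (γ.subst x.val : PowerSeries R)
  rw [rescale_eq_mvSubst, rescale_eq_mvSubst]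
  exact (MvPowerSeries.subst_comp_subst_apply (PowerSeries.HasSubst.const x.prop)
    (PowerSeries.HasSubst.smul_X' u).const γ).symm

theorem IsStrictIso.pointHom_rescaleSum {γ : PowerSeries R} {F₁ F₂ : FormalGroup R} [F₁.IsComm]
    [F₂.IsComm] (h : IsStrictIso γ F₁ F₂) (q : ℕ) (u : R) (x : F₂.Point Unit) :
    h.pointHom (rescaleSum F₂ q u x) = rescaleSum F₁ q u (h.pointHom x) := by
  simp only [rescaleSum_apply, map_sum, h.pointHom_rescalePoint]

/-- The coordinate of `F₂` corresponds to the point `γ` of `F₁`. As `pointHom` is injective and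
respects `rescaleSum`, the `p`-typicality of `F₂` can be tested on `γ` inside `F₁`. -/
theorem IsStrictIso.pointHom_pointX_val {γ : PowerSeries R} {F₁ F₂ : FormalGroup R}
    (h : IsStrictIso γ F₁ F₂) : (h.pointHom (pointX F₂)).val = γ :=
  PowerSeries.X_subst γ

end Points

/-! ### Construction of a `p`-typical coordinate. -/

section PTypification

variable {A : Type*} [CommRing A]

theorem cyclotomic_root_pow_eq_one (q : ℕ) (A : Type*) [CommRing A] :
    AdjoinRoot.root (Polynomial.cyclotomic q A) ^ q = 1 := by
  obtain ⟨P, hP⟩ := Polynomial.cyclotomic.dvd_X_pow_sub_one q A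
  have h := congrArg (AdjoinRoot.mk (Polynomial.cyclotomic q A)) hP
  rw [map_mul, AdjoinRoot.mk_self, zero_mul, map_sub, map_pow, AdjoinRoot.mk_X, map_one] at h
  exact sub_eq_zero.mp h

theorem sum_cyclotomic_root_pow {q : ℕ} (hq : q.Prime) (A : Type*) [CommRing A] :
    ∑ i ∈ Finset.range q, AdjoinRoot.root (Polynomial.cyclotomic q A) ^ i = 0 := by
  have := Fact.mk hq
  have h := congrArg (AdjoinRoot.mk (Polynomial.cyclotomic q A)) (Polynomial.cyclotomic_prime A q)
  simpa using h.symm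

theorem modByMonicHom_of {q : ℕ} (hq : q.Prime) (a : A) :
    AdjoinRoot.modByMonicHom (Polynomial.cyclotomic.monic q A)
      (AdjoinRoot.of (Polynomial.cyclotomic q A) a) = Polynomial.C a := by
  nontriviality A
  rw [← AdjoinRoot.mk_C, AdjoinRoot.modByMonicHom_mk]
  refine (Polynomial.modByMonic_eq_self_iff (Polynomial.cyclotomic.monic q A)).mpr ?_
  refine Polynomial.degree_C_le.trans_lt ?_
  rw [Polynomial.degree_cyclotomic]
  exact_mod_cast Nat.totient_pos.mpr hq.pos

variable (F : FormalGroup A) [F.IsComm]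

/-- The map `x(t) ↦ ∑^F_{i < q} x(ζ^i t)` on the points of `F`. -/
def cyclotomicSum (q : ℕ) :
    F.Point Unit →+ (F.map (AdjoinRoot.of (Polynomial.cyclotomic q A))).Point Unit :=
  (rescaleSum (F.map (AdjoinRoot.of (Polynomial.cyclotomic q A))) q
    (AdjoinRoot.root (Polynomial.cyclotomic q A))).comp
    (mapPoint (AdjoinRoot.of (Polynomial.cyclotomic q A)) rfl)

/-- The coefficient of `t^n` in `∑^F_{i < q} x(ζ^i t)`. -/
def cyclotomicCoeff (q n : ℕ) (x : F.Point Unit) : AdjoinRoot (Polynomial.cyclotomic q A) :=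
  PowerSeries.coeff n ((cyclotomicSum F q x).val : PowerSeries _)

variable {F}

theorem sum_pow_pow_eq_natCast {u : A} {q n : ℕ} (hu : u ^ q = 1) (hqn : q ∣ n) (r : ℕ) :
    ∑ i ∈ Finset.range r, (u ^ i) ^ n = r := by
  obtain ⟨k, rfl⟩ := hqn
  have (i : ℕ) : (u ^ i) ^ (q * k) = 1 := by
    rw [← pow_mul, mul_comm, mul_assoc, pow_mul, hu, one_pow]
  simp [this]

/-- The leading coefficients of the sums for two primes `q` and `r` are compatible. -/
theorem cyclotomicCoeff_compatible {q r n : ℕ} (hn : 1 ≤ n) (hq : q ∣ n)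
    (hr : r.Prime) (hrn : r ∣ n) {x : F.Point Unit}
    (hxq : cyclotomicSum F q x ∈ pointFiltration _ n)
    (hxr : cyclotomicSum F r x ∈ pointFiltration _ n) :
    r * cyclotomicCoeff F q n x = q * AdjoinRoot.of (Polynomial.cyclotomic q A)
      ((AdjoinRoot.modByMonicHom (Polynomial.cyclotomic.monic r A)
        (cyclotomicCoeff F r n x)).coeff 0) := by
  let B := AdjoinRoot (Polynomial.cyclotomic q A)
  let ι : A →+* B := AdjoinRoot.of (Polynomial.cyclotomic q A)
  let κ : B →+* AdjoinRoot (Polynomial.cyclotomic r B) :=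
    AdjoinRoot.of (Polynomial.cyclotomic r B)
  let H := F.map (κ.comp ι)
  have h₁ : (F.map ι).map κ = H := map_map_formalGroup _ _ _
  have hc : (cyclotomicMap ι r).comp (AdjoinRoot.of (Polynomial.cyclotomic r A)) = κ.comp ι :=
    RingHom.ext fun a => by simp [cyclotomicMap, κ]
  have hroot : cyclotomicMap ι r (AdjoinRoot.root (Polynomial.cyclotomic r A)) =
      AdjoinRoot.root (Polynomial.cyclotomic r B) := by simp [cyclotomicMap]
  have h₂ : (F.map (AdjoinRoot.of (Polynomial.cyclotomic r A))).map (cyclotomicMap ι r) = H := by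
    rw [map_map_formalGroup, hc]
  have e₁ : mapPoint κ h₁ (cyclotomicSum F q x) = rescaleSum H q
      (κ (AdjoinRoot.root (Polynomial.cyclotomic q A))) (mapPoint (κ.comp ι) rfl x) :=
    mapPoint_rescaleSum κ h₁ q _ _
  have e₂ : mapPoint (cyclotomicMap ι r) h₂ (cyclotomicSum F r x) = rescaleSum H r
      (AdjoinRoot.root (Polynomial.cyclotomic r B)) (mapPoint (κ.comp ι) rfl x) := by
    refine (mapPoint_rescaleSum (cyclotomicMap ι r) h₂ r _ _).trans ?_
    rw [hroot]
    congr 1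
    refine Subtype.ext (PowerSeries.ext fun m => ?_)
    simp only [mapPoint_val, PowerSeries.coeff_map]
    exact congrArg (fun u => u (PowerSeries.coeff m (x.val : PowerSeries A))) hc
  have m₁ : mapPoint κ h₁ (cyclotomicSum F q x) ∈ pointFiltration H n := X_pow_dvd_map κ hxq
  have m₂ : mapPoint (cyclotomicMap ι r) h₂ (cyclotomicSum F r x) ∈ pointFiltration H n :=
    X_pow_dvd_map (cyclotomicMap ι r) hxr
  -- Over `A[ζ_q][ζ_r]` the double sum of `x` can be formed in either order. As `q` and `r` divide
  -- `n`, comparing coefficients of `t^n` gives `r c_q = q c_r`.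
  have key : PowerSeries.coeff n ((rescaleSum H r (AdjoinRoot.root (Polynomial.cyclotomic r B))
        (mapPoint κ h₁ (cyclotomicSum F q x))).val : PowerSeries _) =
      PowerSeries.coeff n ((rescaleSum H q (κ (AdjoinRoot.root (Polynomial.cyclotomic q A)))
        (mapPoint (cyclotomicMap ι r) h₂ (cyclotomicSum F r x))).val : PowerSeries _) := by
    rw [e₁, e₂, rescaleSum_comm]
  rw [coeff_rescaleSum hn _ _ m₁, coeff_rescaleSum hn _ _ m₂,
    sum_pow_pow_eq_natCast (cyclotomic_root_pow_eq_one r B) hrn,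
    sum_pow_pow_eq_natCast (by rw [← map_pow, cyclotomic_root_pow_eq_one, map_one]) hq,
    mapPoint_val, mapPoint_val, PowerSeries.coeff_map, PowerSeries.coeff_map] at key
  -- Take the coordinate at 1 in the basis of powers of `ζ_r` over `A[ζ_q]`. The left side is
  -- constant in `ζ_r`, and the coordinate of `c_r` already lies in `A`.
  have key' := congrArg (fun z => (AdjoinRoot.modByMonicHom
    (Polynomial.cyclotomic.monic r B) z).coeff 0) key
  simp only [← nsmul_eq_mul, map_nsmul, Polynomial.coeff_smul] at key'
  rw [modByMonicHom_of hr, modByMonicHom_cyclotomicMap, Polynomial.coeff_map,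
    Polynomial.coeff_C_zero] at key'
  rw [nsmul_eq_mul, nsmul_eq_mul] at key'
  exact key'

/-- The sum is invariant under `t ↦ ζt`, so `ζ^n c = c`. Since `n` is invertible modulo `q`, also `ζ
c = c`; summing over the powers of `ζ` gives `q c = 0`. This works for every coefficient, not only
the leading one. -/
theorem cyclotomicCoeff_eq_zero {q n : ℕ} (hq : q.Prime) (hu : IsUnit (q : A)) (hqn : ¬ q ∣ n)
    (x : F.Point Unit) : cyclotomicCoeff F q n x = 0 := by
  set ζ := AdjoinRoot.root (Polynomial.cyclotomic q A) with hζ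
  set c := cyclotomicCoeff F q n x with hc
  have hζq : ζ ^ q = 1 := cyclotomic_root_pow_eq_one q A
  have h : ζ ^ n * c = c := by
    have e : rescalePoint _ ζ (cyclotomicSum F q x) = cyclotomicSum F q x :=
      rescalePoint_rescaleSum hq.one_le hζq _
    rw [hc, cyclotomicCoeff]
    conv_rhs => rw [← e, rescalePoint_val, PowerSeries.coeff_rescale]
  have hpow (k : ℕ) : (ζ ^ n) ^ k * c = c := by
    induction k with
    | zero => rw [pow_zero, one_mul]
    | succ k ih => rw [pow_succ, mul_assoc, h, ih]
  obtain ⟨k, -, hk⟩ := Nat.exists_mul_mod_eq_one_of_coprime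
    ((Nat.Prime.coprime_iff_not_dvd hq).mpr hqn).symm hq.one_lt
  have h1 : (ζ ^ n) ^ k = ζ := by
    rw [← pow_mul, ← Nat.div_add_mod (n * k) q, hk, pow_add, pow_mul, hζq, one_pow, one_mul,
      pow_one]
  have h2 (i : ℕ) : ζ ^ i * c = c := by rw [← h1, ← pow_mul, hpow]
  have h3 : (q : AdjoinRoot (Polynomial.cyclotomic q A)) * c = 0 := by
    have := congrArg (· * c) (sum_cyclotomic_root_pow hq A)
    simpa only [Finset.sum_mul, ← hζ, h2, zero_mul, Finset.sum_const, Finset.card_range,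
      nsmul_eq_mul] using this
  have hu' : IsUnit (q : AdjoinRoot (Polynomial.cyclotomic q A)) := by
    simpa using hu.map (AdjoinRoot.of (Polynomial.cyclotomic q A))
  exact hu'.mul_right_eq_zero.mp h3

theorem cyclotomicSum_mem {n : ℕ} (q : ℕ) {x : F.Point Unit} (hx : x ∈ pointFiltration F n) :
    cyclotomicSum F q x ∈ pointFiltration _ n :=
  rescaleSum_mem q _ (X_pow_dvd_map _ hx)

theorem cyclotomicCoeff_monomial (a : A) {q n : ℕ} (hn : 1 ≤ n) (hqn : q ∣ n) :
    cyclotomicCoeff F q n (pointMonomial F a hn) =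
      q * AdjoinRoot.of (Polynomial.cyclotomic q A) a := by
  rw [cyclotomicCoeff, cyclotomicSum, AddMonoidHom.comp_apply, coeff_rescaleSum hn,
    sum_pow_pow_eq_natCast (cyclotomic_root_pow_eq_one q A) hqn, mapPoint_val,
    PowerSeries.coeff_map]
  · congr 2
    exact (PowerSeries.coeff_C_mul_X_pow a n n).trans (if_pos rfl)
  · exact X_pow_dvd_map _ (pointMonomial_mem a hn)

/-- `x` is `p`-typical modulo `t^n`. -/
def IsPTypicalMod (p n : ℕ) (x : F.Point Unit) : Prop :=
  ∀ q : ℕ, q.Prime → q ≠ p → cyclotomicSum F q x ∈ pointFiltration _ n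

/-- A point that is `p`-typical modulo `t^n` can be modified in degree `n` so as to be `p`-typical
modulo `t^(n+1)`. -/
theorem exists_isPTypicalMod_succ {p : ℕ} (hA : ∀ q : ℕ, q.Prime → q ≠ p → IsUnit (q : A))
    {n : ℕ} (hn : 1 ≤ n) {x : F.Point Unit}
    (hx : IsPTypicalMod p n x) :
    ∃ a : A, IsPTypicalMod p (n + 1) (x + pointMonomial F a hn) := by
  have main (a : A) (ha : ∀ q : ℕ, q.Prime → q ≠ p → q ∣ n →
      cyclotomicCoeff F q n x + q * AdjoinRoot.of (Polynomial.cyclotomic q A) a = 0) :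
      IsPTypicalMod p (n + 1) (x + pointMonomial F a hn) := by
    intro q hq hqp
    have hm := cyclotomicSum_mem q (pointMonomial_mem (F := F) a hn)
    refine X_pow_succ_dvd ?_ ?_
    · rw [map_add]
      exact add_mem (hx q hq hqp) hm
    · by_cases hqn : q ∣ n
      · rw [map_add, coeff_add_of_mem hn (hx q hq hqp) hm]
        exact (congrArg _ (cyclotomicCoeff_monomial a hn hqn)).trans (ha q hq hqp hqn)
      · exact cyclotomicCoeff_eq_zero hq (hA q hq hqp) hqn _
  by_cases hr : ∃ r : ℕ, r.Prime ∧ r ≠ p ∧ r ∣ n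
  · obtain ⟨r, hr, hrp, hrn⟩ := hr
    obtain ⟨v, hv⟩ := hA r hr hrp
    -- The witness is `-r⁻¹` times the coordinate of `c_r` at 1, for one chosen prime `r`.
    -- Compatibility makes it cancel `c_q` for every `q ∣ n`. Taking `q = r` shows that `c_r` itself
    -- lies in `A`.
    refine ⟨-(((v⁻¹ : Aˣ) : A) * (AdjoinRoot.modByMonicHom (Polynomial.cyclotomic.monic r A)
        (cyclotomicCoeff F r n x)).coeff 0), main _ fun q hq hqp hqn => ?_⟩
    have key := cyclotomicCoeff_compatible hn hqn hr hrn (hx q hq hqp) (hx r hr hrp)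
    set ι := AdjoinRoot.of (Polynomial.cyclotomic q A)
    have hv1 : (r : AdjoinRoot (Polynomial.cyclotomic q A)) * ι ((v⁻¹ : Aˣ) : A) = 1 := by
      rw [← map_natCast ι, ← map_mul, ← hv, Units.mul_inv, map_one]
    rw [map_neg, map_mul]
    linear_combination (ι ((v⁻¹ : Aˣ) : A)) * key - cyclotomicCoeff F q n x * hv1
  · exact ⟨0, main 0 fun q hq hqp hqn => absurd ⟨q, hq, hqp, hqn⟩ hr⟩

/-- No prime divides 1, so the coefficient of `t` vanishes without correction. Starting modulo `t²`
keeps the linear coefficient equal to 1, which makes the limit strict. -/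
theorem isPTypicalMod_two_pointX {p : ℕ} (hA : ∀ q : ℕ, q.Prime → q ≠ p → IsUnit (q : A)) :
    IsPTypicalMod p 2 (pointX F) := fun q hq hqp =>
  X_pow_succ_dvd (n := 1)
    (cyclotomicSum_mem q (x := pointX F) (dvd_of_eq (pow_one (PowerSeries.X : PowerSeries A))))
    (cyclotomicCoeff_eq_zero hq (hA q hq hqp) (fun h => hq.one_lt.ne' (Nat.dvd_one.mp h)) _)

variable (F) in
/-- Successive approximations to a `p`-typical point. -/
def approximation {p : ℕ} (hA : ∀ q : ℕ, q.Prime → q ≠ p → IsUnit (q : A)) :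
    ∀ n : ℕ, {x : F.Point Unit // IsPTypicalMod p (n + 2) x}
  | 0 => ⟨pointX F, isPTypicalMod_two_pointX hA⟩
  | n + 1 => ⟨_, (exists_isPTypicalMod_succ hA (Nat.le_add_left 1 (n + 1))
      (approximation hA n).2).choose_spec⟩

theorem X_pow_dvd_approximation_succ_sub {p : ℕ} (hA : ∀ q : ℕ, q.Prime → q ≠ p → IsUnit (q : A))
    (n : ℕ) :
    PowerSeries.X ^ (n + 2) ∣
      ((approximation F hA (n + 1)).1.val - (approximation F hA n).1.val : PowerSeries A) := by
  have h := X_pow_dvd_formalAdd_sub F.toPowerSeries (n := n + 2)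
    (approximation F hA n).1.prop (approximation F hA n).1.prop
    (pointMonomial F (exists_isPTypicalMod_succ hA (Nat.le_add_left 1 (n + 1))
      (approximation F hA n).2).choose (Nat.le_add_left 1 (n + 1))).prop
    PowerSeries.HasSubst.zero'
    (by rw [sub_self]; exact dvd_zero _) (by rw [sub_zero]; exact pointMonomial_mem _ _)
  rw [F.add_zero (approximation F hA n).1.prop] at h
  exact h

theorem X_pow_dvd_approximation_sub {p : ℕ} (hA : ∀ q : ℕ, q.Prime → q ≠ p → IsUnit (q : A))
    {m n : ℕ} (hmn : m ≤ n) :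
    PowerSeries.X ^ (m + 2) ∣
      ((approximation F hA n).1.val - (approximation F hA m).1.val : PowerSeries A) := by
  induction n, hmn using Nat.le_induction with
  | base => rw [sub_self]; exact dvd_zero _
  | succ n hmn ih =>
    have h := dvd_add ((pow_dvd_pow _ (by omega)).trans
      (X_pow_dvd_approximation_succ_sub (F := F) hA n)) ih
    rwa [sub_add_sub_cancel] at h

variable (F) in
/-- Every commutative formal group law over a `ℤ_(p)`-algebra has a `p`-typical coordinate. -/
theorem exists_pTypical_series {p : ℕ} (hA : ∀ q : ℕ, q.Prime → q ≠ p → IsUnit (q : A)) :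
    ∃ γ : PowerSeries A, ∃ hγ : PowerSeries.constantCoeff γ = 0,
    PowerSeries.coeff 1 γ = 1 ∧ ∀ q : ℕ, q.Prime → q ≠ p →
      cyclotomicSum F q ⟨γ, PowerSeries.HasSubst.of_constantCoeff_zero' hγ⟩ = 0 := by
  let γ : PowerSeries A :=
    -- The `n`-th approximation is final modulo `t^(n+2)`, so its coefficient of `t^n` no longer
    -- changes.
    PowerSeries.mk fun n => PowerSeries.coeff n ((approximation F hA n).1.val : PowerSeries A)
  have hγ (n : ℕ) : PowerSeries.X ^ (n + 2) ∣
      (γ - (approximation F hA n).1.val : PowerSeries A) := by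
    refine PowerSeries.X_pow_dvd_iff.mpr fun m hm => ?_
    rw [map_sub, PowerSeries.coeff_mk]
    rcases le_total m n with h | h
    · rw [← neg_eq_zero, neg_sub, ← map_sub]
      exact PowerSeries.X_pow_dvd_iff.mp (X_pow_dvd_approximation_sub hA h) m (by omega)
    · rw [← map_sub]
      exact PowerSeries.X_pow_dvd_iff.mp (X_pow_dvd_approximation_sub hA h) m hm
  have h0 (m : ℕ) (hm : m < 2) : PowerSeries.coeff m γ = PowerSeries.coeff m PowerSeries.X := by
    rw [← sub_eq_zero, ← map_sub]
    exact PowerSeries.X_pow_dvd_iff.mp (hγ 0) m hm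
  have hγ0 : PowerSeries.constantCoeff γ = 0 := by
    rw [← PowerSeries.coeff_zero_eq_constantCoeff_apply, h0 0 (by omega), PowerSeries.coeff_zero_X]
  refine ⟨γ, hγ0, by rw [h0 1 (by omega), PowerSeries.coeff_one_X], fun q hq hqp => ?_⟩
  refine Subtype.ext (PowerSeries.ext fun n => ?_)
  have h1 := X_pow_dvd_rescaleSum_sub (G := F.map (AdjoinRoot.of (Polynomial.cyclotomic q A))) q
    (AdjoinRoot.root (Polynomial.cyclotomic q A)) (n := n + 2)
    (x := mapPoint (AdjoinRoot.of (Polynomial.cyclotomic q A)) rfl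
      ⟨γ, PowerSeries.HasSubst.of_constantCoeff_zero' hγ0⟩)
    (y := mapPoint (AdjoinRoot.of (Polynomial.cyclotomic q A)) rfl (approximation F hA n).1)
    (map_sub (PowerSeries.map (AdjoinRoot.of (Polynomial.cyclotomic q A))) γ _ ▸
      X_pow_dvd_map _ (hγ n))
  have h2 := dvd_add h1 ((approximation F hA n).2 q hq hqp)
  rw [cyclotomicSum, AddMonoidHom.comp_apply, sub_add_cancel] at h2
  exact PowerSeries.X_pow_dvd_iff.mp h2 n (by omega)

variable (F) in
/-- Every commutative formal group law over a `ℤ_(p)`-algebra is strictly isomorphic to a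
`p`-typical one. -/
theorem exists_isPTypical_strictlyIsomorphic
    {p : ℕ} (hA : ∀ q : ℕ, q.Prime → q ≠ p → IsUnit (q : A)) :
    ∃ F' : FormalGroup A, F'.IsComm ∧ IsPTypical p F' ∧ StrictlyIsomorphic F F' := by
  obtain ⟨γ, hγ0, hγ1, hγ⟩ := exists_pTypical_series F hA
  have hu : IsUnit (PowerSeries.coeff 1 γ) := hγ1 ▸ isUnit_one
  -- The law sought is `γ⁻¹(F(γ(x), γ(y)))`, which is the twist of `F` by the inverse series.
  set δ := γ.substInvOfIsUnit hu with hδ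
  have hδ0 : PowerSeries.constantCoeff δ = 0 := γ.constantCoeff_substInvOfIsUnit hu
  have hδ1 : PowerSeries.coeff 1 δ = 1 := by
    rw [hδ, γ.coeff_one_substInvOfIsUnit, inv_eq_one.mpr (Units.ext hγ1)]
    rfl
  have hiso : IsStrictIso γ F (twist F δ hδ0 hδ1) := by
    have h := (isStrictIso_twist F δ hδ0 hδ1).symm
    have e : δ.substInvOfIsUnit (hδ1 ▸ isUnit_one) = γ := by
      have hγs : PowerSeries.HasSubst γ := PowerSeries.HasSubst.of_constantCoeff_zero' hγ0
      have h' := substInv_subst_subst hδ0 (hδ1 ▸ isUnit_one) hγs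
      have h'' : (δ.subst γ : PowerSeries A) = PowerSeries.X :=
        γ.subst_substInvOfIsUnit_left hγ0 hu
      rw [h''] at h'
      exact (PowerSeries.X_subst _).symm.trans h'
    rwa [e] at h
  refine ⟨twist F δ hδ0 hδ1, isComm_twist F δ hδ0 hδ1, fun q hq hqp => ?_, γ, hiso⟩
  have := isComm_twist F δ hδ0 hδ1
  have hmap := hiso.map (AdjoinRoot.of (Polynomial.cyclotomic q A))
  have key : rescaleSum ((twist F δ hδ0 hδ1).map (AdjoinRoot.of (Polynomial.cyclotomic q A))) q
      (AdjoinRoot.root (Polynomial.cyclotomic q A)) (pointX _) = 0 := by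
    -- Over `A[ζ]`, `γ` carries the sum for the coordinate `t` to the sum for the point `γ` of `F`,
    -- which is 0 by construction.
    apply hmap.pointHom_injective
    rw [hmap.pointHom_rescaleSum, map_zero, ← hγ q hq hqp]
    exact congrArg _ (Subtype.ext hmap.pointHom_pointX_val)
  rw [rootSum, formalSum_eq_rescaleSum, key]
  rfl

end PTypification

/-! ### The map from `BP` to the localized Lazard ring, and the conclusion. -/

theorem exists_strictlyIsomorphic_universalPTypical (p : ℕ) [hp : Fact p.Prime] :
    ∃ g : BP p →+* LazardLoc p,
      StrictlyIsomorphic (universalLoc p) ((universalPTypical p).map g) := by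
  have hA (n : ℤ) (hn : ¬ (p : ℤ) ∣ n) : IsUnit (n : LazardLoc p) := by
    have h := IsLocalization.map_units (LazardLoc p)
      (⟨Int.castRingHom Lazard n, n, hn, rfl⟩ : (primeTo p).map (Int.castRingHom Lazard))
    simpa using h
  have : (universalLoc p).IsComm := isComm_map universalFGL _
  obtain ⟨F', hF', hpt, hiso⟩ := exists_isPTypical_strictlyIsomorphic (universalLoc p) (p := p)
    fun q hq hqp => by
      simpa using hA q fun h => hqp ((Nat.prime_dvd_prime_iff_eq hp.out hq).mp
        (Int.natCast_dvd_natCast.mp h)).symm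
  obtain ⟨g, hg, -⟩ := existsUnique_universalPTypical p hA F' hpt
  exact ⟨g, hg ▸ hiso⟩

end LazardBP

end

theorem mainTheorem10 (p : ℕ) [Fact p.Prime]
    (M : Type*) [AddCommGroup M] [Module Lazard M] (C : Comodule M) :
    (∃ g : BP p →+* LazardLoc p,
      StrictlyIsomorphic (universalLoc p) ((universalPTypical p).map g)) ∧
    (∀ g : BP p →+* LazardLoc p,
      StrictlyIsomorphic (universalLoc p) ((universalPTypical p).map g) →
      Nonempty ((LazardLoc p ⊗[Lazard] M) ≃ₗ[LazardLoc p]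
        (Via g ⊗[BP p] (BP p ⊗[Lazard] M)))) ∧
    (∀ (A : Type*) [CommRing A] (f₁ f₂ : Lazard →+* A) (γ : PowerSeries A),
      IsStrictIso γ (universalFGL.map f₁) (universalFGL.map f₂) →
      ∃! h : (Via f₁ ⊗[Lazard] M) ≃ₗ[A] (Via f₂ ⊗[Lazard] M),
        ∀ m : M, h (1 ⊗ₜ[Lazard] m) =
          (evalLB f₂ γ).toLinearMap.rTensor M (C.coaction m)) := by
  exact ⟨exists_strictlyIsomorphic_universalPTypical p,
    nonempty_equiv_of_strictlyIsomorphic p C, fun _ _ _ _ _ h => existsUnique_comparison C h⟩
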